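/- Let $\mathbf{k}$ be a field of characteristic $0$. Let $R_1(M_8)=\Gamma\big((\mathbb{P}^1)^8,\mathcal{O}(1)^{\boxtimes 8}\big)^{\mathrm{SL}_2}$ be the space of polynomials in the coordinates $(x_i,y_i)$, $1\le i\le 8$, of eight points of $\mathbb{P}^1$ that are homogeneous of degree $1$ in each pair $(x_i,y_i)$ and invariant under $\mathrm{SL}_2$, with $\mathfrak{S}_8$ acting by permuting the eight points. Then $\dim R_1(M_8)=14$; the space of skew-invariant cubics, that is, of elements of $\mathrm{Sym}^3 R_1(M_8)$ on which $\mathfrak{S}_8$ acts through the sign character, is one-dimensional; and for every non-zero skew-invariant cubic $\mathcal{C}$, the $14$ partial derivatives of $\mathcal{C}$ have no linear syzygies: if $x_1,\dots,x_{14}$ is any basis of $R_1(M_8)$, if $\partial/\partial x_i$ denotes the derivation of $\mathrm{Sym}\,R_1(M_8)$ given on $R_1(M_8)$ by the $i$-th element of the dual basis, and if $y_1,\dots,y_{14}\in R_1(M_8)$ satisfy $\sum_{i=1}^{14} y_i\,\frac{\partial\mathcal{C}}{\partial x_i}=0$ in $\mathrm{Sym}^3 R_1(M_8)$, then $y_i=0$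 for all $i$. Equivalently, the annihilator of $\mathcal{C}$ in $\mathfrak{gl}(R_1(M_8))$ is zero, where $A\in\mathfrak{gl}(R_1(M_8))$ acts on $\mathrm{Sym}\,R_1(M_8)$ as the derivation extending $A$. -/

import Mathlib

namespace EightPoints

open MvPolynomial

/-! Polynomials on `n` points of the projective line: the pair of variables `X (i, 0)`, `X (i, 1)`
holds the homogeneous coordinates of the `i`-th point. -/

/-- The substitution replacing the coordinate vector `(x_i, y_i)` of every point by `g (x_i, y_i)`,
for a `2 × 2` matrix `g`. -/
noncomputable def subst (k : Type*) [Field k] (n : ℕ) (g : Matrix (Fin 2) (Fin 2) k) :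
    MvPolynomial (Fin n × Fin 2) k →ₐ[k] MvPolynomial (Fin n × Fin 2) k :=
  aeval fun q => ∑ b : Fin 2, C (g q.2 b) * X (q.1, b)

/-- `Γ((ℙ¹)ⁿ, 𝒪(d)^{⊠ n})^{SL₂}`: the polynomials in the coordinates of `n` points of `ℙ¹` which are
homogeneous of degree `d` in the coordinates of each point and invariant under `SL₂`. -/
noncomputable def invariantForms (k : Type*) [Field k] (n d : ℕ) :
    Submodule k (MvPolynomial (Fin n × Fin 2) k) where
  carrier := {p | (∀ i : Fin n,
        IsWeightedHomogeneous (fun q : Fin n × Fin 2 => if q.1 = i then 1 else 0) p d) ∧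
      ∀ g : Matrix.SpecialLinearGroup (Fin 2) k, subst k n g.1 p = p}
  zero_mem' := ⟨fun _ => isWeightedHomogeneous_zero k _ _, fun _ => map_zero _⟩
  add_mem' := fun hp hq =>
    ⟨fun i => (hp.1 i).add (hq.1 i), fun g => by rw [map_add, hp.2 g, hq.2 g]⟩
  smul_mem' := fun c p hp =>
    ⟨fun i => (weightedHomogeneousSubmodule k _ d).smul_mem c (hp.1 i),
      fun g => by rw [map_smul, hp.2 g]⟩

/-- `R₁(M₈)`: the degree one piece of the ring of invariants of eight points on `ℙ¹`. -/
noncomputable abbrev R₁ (k : Type*) [Field k] : Submodule k (MvPolynomial (Fin 8 × Fin 2) k) :=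
  invariantForms k 8 1

theorem rename_mem {k : Type*} [Field k] {n d : ℕ} (σ : Equiv.Perm (Fin n))
    {p : MvPolynomial (Fin n × Fin 2) k} (hp : p ∈ invariantForms k n d) :
    rename (Prod.map σ id) p ∈ invariantForms k n d := by
  refine ⟨fun i => ?_, fun g => ?_⟩
  · intro m hm
    obtain ⟨u, rfl, hu⟩ := coeff_rename_ne_zero _ _ _ hm
    rw [← hp.1 (σ.symm i) hu, Finsupp.weight_apply, Finsupp.weight_apply,
      Finsupp.sum_mapDomain_index (by simp) (fun _ _ _ => add_smul _ _ _)]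
    simp [Equiv.eq_symm_apply]
  · conv_rhs => rw [← hp.2 g]
    rw [← AlgHom.comp_apply, ← AlgHom.comp_apply]
    congr 1
    ext q
    simp [subst]

/-- The action of `𝔖ₙ` on invariants by permuting the `n` points. -/
noncomputable def permRep (k : Type*) [Field k] (n d : ℕ) :
    Representation k (Equiv.Perm (Fin n)) (invariantForms k n d) where
  toFun σ := (rename (R := k) (Prod.map σ id)).toLinearMap.restrict fun _ hp => rename_mem σ hp
  map_one' := by
    ext p : 2
    simp [LinearMap.restrict_apply]
  map_mul' σ τ := by
    ext p : 2
    change rename (Prod.map (σ * τ) id) p.1 =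
      rename (Prod.map σ id) (rename (Prod.map τ id) p.1)
    rw [rename_rename]
    rfl

section Sym

variable {k V : Type*} [Field k] [AddCommGroup V] [Module k V]

variable (k V) in
/-- The `d`-th symmetric power of `V`, as the degree `d` piece of the symmetric algebra. -/
noncomputable def symPower (d : ℕ) : Submodule k (SymmetricAlgebra k V) :=
  LinearMap.range (SymmetricAlgebra.ι k V) ^ d

/-- The algebra endomorphism of `Sym V` induced by an endomorphism of `V`. -/
noncomputable def symMap (f : V →ₗ[k] V) : SymmetricAlgebra k V →ₐ[k] SymmetricAlgebra k V :=
  SymmetricAlgebra.lift (SymmetricAlgebra.ι k V ∘ₗ f)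

/-- The algebra homomorphism `s ↦ s + ε D s` to the dual numbers over `Sym V`, where `D` is the
derivation extending `φ`. -/
noncomputable def dualLift (φ : V →ₗ[k] SymmetricAlgebra k V) :
    SymmetricAlgebra k V →ₐ[k] DualNumber (SymmetricAlgebra k V) :=
  SymmetricAlgebra.lift
    ((TrivSqZeroExt.inlAlgHom k _ _).toLinearMap ∘ₗ SymmetricAlgebra.ι k V +
      (TrivSqZeroExt.inrHom _ _).restrictScalars k ∘ₗ φ)

theorem fst_dualLift (φ : V →ₗ[k] SymmetricAlgebra k V) (s : SymmetricAlgebra k V) :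
    (dualLift φ s).fst = s := by
  have h : (TrivSqZeroExt.fstHom k _ _).comp (dualLift φ) = AlgHom.id k _ := by
    ext v
    simp [dualLift]
  exact congr($h s)

/-- The `k`-linear derivation of the algebra `Sym V` which extends a linear map `φ : V → Sym V`. -/
noncomputable def symDerivation (φ : V →ₗ[k] SymmetricAlgebra k V) :
    Derivation k (SymmetricAlgebra k V) (SymmetricAlgebra k V) :=
  Derivation.mk' ((TrivSqZeroExt.sndHom _ _).restrictScalars k ∘ₗ (dualLift φ).toLinearMap)
    fun a b => by
      simp [TrivSqZeroExt.snd_mul, fst_dualLift, mul_comm]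

theorem symDerivation_ι (φ : V →ₗ[k] SymmetricAlgebra k V) (v : V) :
    symDerivation φ (SymmetricAlgebra.ι k V v) = φ v := by
  simp [symDerivation, dualLift]

/-- For `l` in the dual of `V`, the partial derivative `∂/∂l`: the derivation of `Sym V` given on
`V` by `l`. -/
noncomputable def partialDeriv (l : Module.Dual k V) :
    Derivation k (SymmetricAlgebra k V) (SymmetricAlgebra k V) :=
  symDerivation (Algebra.linearMap k (SymmetricAlgebra k V) ∘ₗ l)

/-- The action of `A ∈ 𝔤𝔩(V)` on `Sym V`: the derivation given on `V` by `A`. -/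
noncomputable def lieAction (A : Module.End k V) :
    Derivation k (SymmetricAlgebra k V) (SymmetricAlgebra k V) :=
  symDerivation (SymmetricAlgebra.ι k V ∘ₗ A)

end Sym

/-- The space of skew-invariant cubics: the elements of `Sym³ R₁(M₈)` on which `𝔖₈` acts through the
sign character. -/
noncomputable def skewCubics (k : Type*) [Field k] : Submodule k (SymmetricAlgebra k (R₁ k)) where
  carrier := {c | c ∈ symPower k (R₁ k) 3 ∧
    ∀ σ : Equiv.Perm (Fin 8), symMap (permRep k 8 1 σ) c = (Equiv.Perm.sign σ : ℤ) • c}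
  zero_mem' := ⟨zero_mem _, fun _ => by simp⟩
  add_mem' := fun ha hb =>
    ⟨add_mem ha.1 hb.1, fun σ => by rw [map_add, ha.2, hb.2, smul_add]⟩
  smul_mem' := fun r c hc =>
    ⟨Submodule.smul_mem _ r hc.1, fun σ => by rw [map_smul, hc.2, smul_comm]⟩

end EightPoints

/-!
The proof writes the cubic down in fifteen spanning vectors of `R₁` that are indexed by the nonzero
vectors of `𝔽₂⁴`, on which even permutations act through `𝔄₈ ≅ GL₄(𝔽₂)`.

A form in `R₁` is determined by its values at the configurations whose points are `(1, 0)` on a set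
`S` and `(0, 1)` off it. By invariance under the torus these vanish unless `S` has four elements,
and by invariance under the unipotent matrices the sum of the values over all sets containing a
fixed set of less than four points is zero (`evalVertex_eq_zero`, `sum_superset_evalVertex`).

The eight points are labelled by a Kerdock set of alternating forms `ω_0, …, ω_7` on `𝔽₂⁴`, whose
pairwise sums are nondegenerate. For `p ≠ 0` the four-point sets `S` with `∑ i ∈ S, ω_i p = 0` are
the blocks of a Steiner system `S(3, 4, 8)`. The function with the values `4` on blocks and `-1` on
the other four-point sets is that of an invariant form `z_p`, a signed sum of products of brackets
(`sum_matching`). The number of systems in which two four-point sets are both blocks is a polynomial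
of degree four in the size of their intersection. The vanishing of the sums over supersets removes
all terms but the leading one, so the `z_p` span `R₁` (`exists_eq_sum_steinerForm`). A four-point
set is a block exactly for the `p` on one projective line, and every line occurs; hence
`∑ p, z_p = 0` is the only relation (`sum_smul_steinerForm_eq_zero`) and `dim R₁ = 14`.

Two kinds of permutations suffice. The transposition of two neighbouring points `i`, `j` acts by the
Fourier transform `z_p ↦ ¼ ∑ q, (-1)^{(ω_i + ω_j)(p, q)} z_q` (`steiner_swap`). Certain products of
four disjoint transpositions act by the transvections `p ↦ p + (φ · p) v` (`steiner_translation`).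
The Fourier transform exchanges `4 ∑ z_p³` and `∑_{p + q + r = 0} z_p z_q z_r`, so their difference
`C` is a skew-invariant cubic (`sum_fourier_cube`, `symMap_skewCubic`). It is the only one: the
antisymmetrization of `z_p z_q z_r` depends only on the orbit of `(p, q, r)` under transvections,
and the relation `∑ p, z_p = 0` with the sign rule under one transposition expresses all of them
through that of `z_p³` (`exists_smul_eq_of_transvection`).

If `A` annihilates `C` and `A z_p = ∑ q, a_{pq} z_q`, where one may take `a_{pp} = 0`, then
comparing coefficients gives a linear system for the matrix `a`. Summing it over one and then over
two of its three indices shows that the row and column sums vanish. What is left is a system of six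
equations for the six entries of each line, and it is regular
(`eq_zero_of_annihilatorForm_eq_zero`). With `A = 1` this also shows `C ≠ 0`. A linear syzygy
`∑ y_i ∂C/∂x_i = 0` says that the map `A` with `A x_i = y_i` annihilates `C`
(`sum_mul_partialDeriv`).
-/

namespace EightPoints

open MvPolynomial

/-! ### The affine space `𝔽₂⁴` and the Kerdock set -/

/-- The vector space `𝔽₂⁴`. A vector is stored as its bitmask, addition is bitwise `xor`. -/
def Vec : Type := Fin 16

namespace Vec

instance : DecidableEq Vec := inferInstanceAs (DecidableEq (Fin 16))
instance : Fintype Vec := inferInstanceAs (Fintype (Fin 16))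

/-- The bitmask of a vector. -/
def bits (x : Vec) : ℕ := Fin.val x

/-- The vector with a given bitmask. -/
def ofFin (x : Fin 16) : Vec := x

instance : Add Vec := ⟨fun x y => (Fin.xor x y : Fin 16)⟩
instance : Zero Vec := ⟨(0 : Fin 16)⟩
instance : One Vec := ⟨(1 : Fin 16)⟩
instance (n : ℕ) [n.AtLeastTwo] : OfNat Vec n := inferInstanceAs (OfNat (Fin 16) n)
instance : Neg Vec := ⟨id⟩

instance : AddCommGroup Vec where
  add_assoc := by decide +kernel
  zero_add := by decide +kernel
  add_zero := by decide +kernel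
  add_comm := by decide +kernel
  neg_add_cancel := by decide +kernel
  nsmul := nsmulRec
  zsmul := zsmulRec

theorem add_self : ∀ x : Vec, x + x = 0 := by decide +kernel

theorem add_eq_zero_iff {x y : Vec} : x + y = 0 ↔ x = y :=
  ⟨fun h => by rw [← add_zero x, ← add_self y, ← add_assoc, h, zero_add],
    fun h => by rw [h, add_self]⟩

theorem add_add_cancel (x y : Vec) : x + (x + y) = y := by
  rw [← add_assoc, add_self, zero_add]

theorem sum_bits : ∀ x : Vec, x = (if x.bits.testBit 0 then 1 else 0) +
    (if x.bits.testBit 1 then 2 else 0) + (if x.bits.testBit 2 then 4 else 0) +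
      (if x.bits.testBit 3 then 8 else 0) := by
  decide +kernel

theorem addMonoidHom_ext {f g : Vec →+ Vec} (h : ∀ x ∈ ([1, 2, 4, 8] : List Vec), f x = g x) :
    f = g := by
  have hif (b : Bool) (y : Vec) (hy : f y = g y) :
      f (if b then y else 0) = g (if b then y else 0) := by
    cases b
    · simp
    · simpa using hy
  ext x
  rw [sum_bits x]
  simp only [map_add]
  rw [hif _ 1 (h _ (by simp)), hif _ 2 (h _ (by simp)), hif _ 4 (h _ (by simp)),
    hif _ 8 (h _ (by simp))]

theorem card_eq : Fintype.card Vec = 16 := by decide +kernel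

end Vec

/-- The standard bilinear form on `𝔽₂⁴`, which identifies `𝔽₂⁴` with its dual. -/
def dot (x y : Vec) : Bool :=
  (x.bits &&& y.bits).testBit 0 ^^ (x.bits &&& y.bits).testBit 1 ^^
    (x.bits &&& y.bits).testBit 2 ^^ (x.bits &&& y.bits).testBit 3

theorem dot_comm : ∀ x y : Vec, dot x y = dot y x := by decide +kernel

theorem dot_add : ∀ x y z : Vec, dot x (y + z) = (dot x y ^^ dot x z) := by decide +kernel

theorem dot_zero : ∀ x : Vec, dot x 0 = false := by decide +kernel

/-- The additive character `y ↦ (-1) ^ (x · y)` of `𝔽₂⁴`. -/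
def chi (x y : Vec) : ℤ := if dot x y then -1 else 1

theorem chi_add (x y z : Vec) : chi x (y + z) = chi x y * chi x z := by
  simp only [chi, dot_add]
  cases dot x y <;> cases dot x z <;> rfl

/-- The images of the four basis vectors under the eight alternating matrices of the Kerdock set. -/
def kerdockRow : Fin 8 → Fin 4 → Vec :=
  ![![0, 0, 0, 0], ![8, 4, 2, 1], ![12, 8, 1, 3], ![6, 13, 3, 2],
    ![14, 1, 9, 5], ![2, 5, 10, 4], ![10, 9, 8, 7], ![4, 12, 11, 6]]

/-- The value `ω_i p` of the `i`-th form of the Kerdock set: `ω_0, …, ω_7` are alternating bilinear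
forms on `𝔽₂⁴`, seen as linear maps from `𝔽₂⁴` to its dual, and `ω_i + ω_j` is nondegenerate for all
`i ≠ j`. The eight forms are labelled by the eight points. -/
def kerdock (i : Fin 8) (p : Vec) : Vec :=
  (if p.bits.testBit 0 then kerdockRow i 0 else 0) +
    (if p.bits.testBit 1 then kerdockRow i 1 else 0) +
      (if p.bits.testBit 2 then kerdockRow i 2 else 0) +
        if p.bits.testBit 3 then kerdockRow i 3 else 0

theorem kerdock_add : ∀ i p q, kerdock i (p + q) = kerdock i p + kerdock i q := by
  decide +kernel

/-- The value at `p` of the form `ω_i + ω_j`, which is symplectic for `i ≠ j`. -/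
def polar (i j : Fin 8) (p : Vec) : Vec := kerdock i p + kerdock j p

theorem sum_chi_polar : ∀ a : Fin 7, ∀ q : Vec,
    ∑ p, chi (polar a.castSucc a.succ p) q = if q = 0 then 16 else 0 := by
  decide +kernel

/-! ### Fifteen Steiner systems on eight points -/

/-- For `p ≠ 0` the sets `S` of four points with `∑ i ∈ S, ω_i p = 0` are the `14` blocks of a
Steiner system `S(3, 4, 8)`. The `15` systems obtained in this way form one orbit of the alternating
group. For `p = 0` every set is a block. -/
def IsBlock (p : Vec) (S : Finset (Fin 8)) : Prop := ∑ i ∈ S, kerdock i p = 0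

instance (p : Vec) (S : Finset (Fin 8)) : Decidable (IsBlock p S) :=
  inferInstanceAs (Decidable (_ = _))

/-- The function on sets of four points with the value `4` on the blocks of the Steiner system of
`p` and the value `-1` elsewhere; zero for `p = 0`. -/
def steiner (p : Vec) (S : Finset (Fin 8)) : ℤ :=
  if p = 0 then 0 else if IsBlock p S then 4 else -1

/-- The set of points with a given bitmask. Statements about all sets of four points are checked on
bitmasks, where the kernel can evaluate them quickly. -/
def ofMask (m : ℕ) : Finset (Fin 8) := Finset.univ.filter fun i => m.testBit i

theorem mem_ofMask {m : ℕ} {i : Fin 8} : i ∈ ofMask m ↔ m.testBit i := by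
  simp [ofMask]

/-- The number of points in the set with a given bitmask. -/
def cardMask (m : ℕ) : ℕ :=
  (m.testBit 0).toNat + (m.testBit 1).toNat + (m.testBit 2).toNat + (m.testBit 3).toNat +
    (m.testBit 4).toNat + (m.testBit 5).toNat + (m.testBit 6).toNat + (m.testBit 7).toNat

theorem card_ofMask (m : ℕ) : (ofMask m).card = cardMask m := by
  have h (b : Bool) : (if b then 1 else 0) = b.toNat := by cases b <;> rfl
  simp only [ofMask, Finset.card_filter, h]
  simp [cardMask, Fin.sum_univ_eight]

theorem exists_ofMask_eq (S : Finset (Fin 8)) : ∃ m < 256, ofMask m = S := by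
  refine ⟨Nat.ofBits fun i : Fin 8 => decide (i ∈ S),
    Nat.ofBits_lt_two_pow fun i : Fin 8 => decide (i ∈ S), ?_⟩
  ext i
  simp [ofMask]

/-- The bitmasks of the sets of four points. -/
def quadMasks : List ℕ := (List.range 256).filter fun m => cardMask m = 4

theorem exists_ofMask_eq_of_card {S : Finset (Fin 8)} (hS : S.card = 4) :
    ∃ m ∈ quadMasks, ofMask m = S := by
  obtain ⟨m, hm, rfl⟩ := exists_ofMask_eq S
  exact ⟨m, by simp [quadMasks, hm, ← card_ofMask, hS], rfl⟩

theorem card_of_mem_quadMasks {m : ℕ} (hm : m ∈ quadMasks) : cardMask m = 4 := by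
  simp only [quadMasks, List.mem_filter, decide_eq_true_eq] at hm
  exact hm.2

/-- The bitmask of the radical of `∑ i ∈ S, ω_i`, where `S` is given by its bitmask. If `S` has four
elements then this is a line of the projective space over `𝔽₂`, together with `0`. -/
def radicalMask (m : ℕ) : ℕ :=
  Nat.ofBits (n := 16) fun p =>
    decide (∑ i : Fin 8, (if m.testBit i then kerdock i (Vec.ofFin p) else 0) = 0)

theorem isBlock_ofMask (p : Vec) (m : ℕ) :
    IsBlock p (ofMask m) ↔ (radicalMask m).testBit p.bits := by
  have h := Nat.testBit_ofBits_lt (n := 16) (fun p => decide (∑ i : Fin 8,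
    (if m.testBit i then kerdock i (Vec.ofFin p) else 0) = 0)) p.bits (Fin.is_lt p)
  rw [radicalMask, h]
  simp only [IsBlock, ofMask, Finset.sum_filter, decide_eq_true_eq]
  rfl

theorem steiner_ofMask (p : Vec) (m : ℕ) :
    steiner p (ofMask m) =
      if p = 0 then 0 else if (radicalMask m).testBit p.bits then 4 else -1 := by
  simp [steiner, isBlock_ofMask]

theorem kerdock_zero : ∀ i, kerdock i 0 = 0 := by decide

theorem isBlock_zero (S : Finset (Fin 8)) : IsBlock 0 S :=
  Finset.sum_eq_zero fun i _ => kerdock_zero i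

/-- The radicals of two sets of four points are equal if the sets are equal or disjoint,
meet in one vector `p ≠ 0` if the sets have two common points, and meet in `0` if the
number of common points is odd. -/
theorem radicalMask_land : ∀ m ∈ quadMasks, ∀ n ∈ quadMasks,
    if (cardMask (m &&& n)).testBit 0 then radicalMask m &&& radicalMask n = 1 else
      if (cardMask (m &&& n)).testBit 1 then
        ∃ p : Vec, p ≠ 0 ∧ radicalMask m &&& radicalMask n = 1 + 2 ^ p.bits
      else radicalMask m = radicalMask n := by
  decide +kernel

theorem sum_radicalMask : ∀ m ∈ quadMasks,
    (∑ p : Vec, if (radicalMask m).testBit p.bits then 1 else 0) = 4 := by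
  decide +kernel

theorem sum_testBit_two_pow : ∀ p : Vec, p ≠ 0 →
    (∑ q : Vec, if (1 + 2 ^ p.bits).testBit q.bits then 1 else 0) = 2 := by
  decide +kernel

theorem card_inter_ofMask (m n : ℕ) : (ofMask m ∩ ofMask n).card = cardMask (m &&& n) := by
  rw [← card_ofMask]
  congr 1
  ext i
  simp [ofMask]

/-- The sets of four points `S` and `T` are blocks of four, two or one common systems (where the
zero vector is counted), according to the number of their common points. -/
theorem card_isBlock_and {S T : Finset (Fin 8)} (hS : S.card = 4) (hT : T.card = 4) :
    (∑ p : Vec, if IsBlock p S ∧ IsBlock p T then (1 : ℤ) else 0) =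
      if Even (S ∩ T).card then if (S ∩ T).card = 2 then 2 else 4 else 1 := by
  obtain ⟨m, hm, rfl⟩ := exists_ofMask_eq_of_card hS
  obtain ⟨n, hn, rfl⟩ := exists_ofMask_eq_of_card hT
  have hle : cardMask (m &&& n) ≤ 4 := by
    rw [← card_inter_ofMask, ← hS]
    exact Finset.card_le_card Finset.inter_subset_left
  have key := radicalMask_land m hm n hn
  have hsum : (∑ p : Vec, if IsBlock p (ofMask m) ∧ IsBlock p (ofMask n) then (1 : ℤ) else 0) =
      ((∑ p : Vec, if (radicalMask m &&& radicalMask n).testBit p.bits then 1 else 0 : ℕ) : ℤ) := by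
    push_cast
    refine Finset.sum_congr rfl fun p _ => ?_
    simp only [isBlock_ofMask, Nat.testBit_land, Bool.and_eq_true]
  rw [hsum, card_inter_ofMask]
  have h1 : (∑ p : Vec, if (1 : ℕ).testBit p.bits then 1 else 0) = 1 := by decide +kernel
  have hm4 := sum_radicalMask m hm
  generalize cardMask (m &&& n) = j at *
  have heq (h : radicalMask m = radicalMask n) :
      radicalMask m &&& radicalMask n = radicalMask m := by
    rw [← h, Nat.and_self]
  have he2 : Even 2 := ⟨1, rfl⟩
  have he4 : Even 4 := ⟨2, rfl⟩
  have ho3 : ¬ Even 3 := by decide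
  interval_cases j
  · rw [heq key, hm4]; simp
  · rw [show radicalMask m &&& radicalMask n = 1 from key, h1]; simp
  · obtain ⟨p, hp, h⟩ : ∃ p : Vec, p ≠ 0 ∧ radicalMask m &&& radicalMask n = 1 + 2 ^ p.bits := key
    rw [h, sum_testBit_two_pow p hp]; simp
  · rw [show radicalMask m &&& radicalMask n = 1 from key, h1]; simp [ho3]
  · rw [heq key, hm4]; simp [he4]

theorem sum_ite_eq_zero_vec (c : ℤ) : (∑ p : Vec, if p = 0 then c else 0) = c := by simp

theorem steiner_mul_steiner {S T : Finset (Fin 8)} (p : Vec) :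
    steiner p S * (steiner p T + 1) = 25 * (if IsBlock p S ∧ IsBlock p T then (1 : ℤ) else 0) -
      5 * (if IsBlock p T ∧ IsBlock p T then (1 : ℤ) else 0) - if p = 0 then 20 else 0 := by
  by_cases hp : p = 0
  · subst hp
    simp [steiner, isBlock_zero]
  · by_cases h1 : IsBlock p S <;> by_cases h2 : IsBlock p T <;> simp [steiner, hp, h1, h2]

/-- Five times the kernel `∑ p, z_p(S) 1_{blocks of p}(T)` is a polynomial of degree four in the
number of common points of `S` and `T`, written here in the binomial basis. -/
theorem sum_steiner_mul_steiner {S T : Finset (Fin 8)} (hS : S.card = 4) (hT : T.card = 4) :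
    ∑ p, steiner p S * (steiner p T + 1) = 5 * (12 - 15 * ((S ∩ T).card.choose 1 : ℤ) +
      20 * ((S ∩ T).card.choose 2 : ℤ) - 30 * ((S ∩ T).card.choose 3 : ℤ) +
        60 * ((S ∩ T).card.choose 4 : ℤ)) := by
  simp only [steiner_mul_steiner, Finset.sum_sub_distrib, ← Finset.mul_sum, card_isBlock_and hS hT,
    card_isBlock_and hT hT, sum_ite_eq_zero_vec]
  have hle : (S ∩ T).card ≤ 4 := hS ▸ Finset.card_le_card Finset.inter_subset_left
  rw [Finset.inter_self, hT]
  have he4 : Even 4 := ⟨2, rfl⟩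
  have ho3 : ¬ Even 3 := by decide
  generalize (S ∩ T).card = j at *
  interval_cases j <;> norm_num [he4, ho3, Nat.choose]

theorem exists_radicalMask_eq : ∀ p q : Vec, p ≠ 0 → q ≠ 0 → p ≠ q →
    ∃ m ∈ quadMasks, radicalMask m = 1 + 2 ^ p.bits + 2 ^ q.bits + 2 ^ (p + q).bits := by
  decide +kernel

theorem testBit_line : ∀ p q : Vec, p ≠ 0 → q ≠ 0 → p ≠ q → ∀ r : Vec,
    (1 + 2 ^ p.bits + 2 ^ q.bits + 2 ^ (p + q).bits).testBit r.bits =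
      decide (r = 0 ∨ r = p ∨ r = q ∨ r = p + q) := by
  decide +kernel

/-- Every line of the projective space over `𝔽₂` consists of the systems in which some set of four
points is a block. -/
theorem exists_isBlock_iff {p q : Vec} (hp : p ≠ 0) (hq : q ≠ 0) (hpq : p ≠ q) :
    ∃ S : Finset (Fin 8), S.card = 4 ∧ ∀ r, IsBlock r S ↔ r = 0 ∨ r = p ∨ r = q ∨ r = p + q := by
  obtain ⟨m, hm, h⟩ := exists_radicalMask_eq p q hp hq hpq
  refine ⟨ofMask m, by rw [card_ofMask, card_of_mem_quadMasks hm], fun r => ?_⟩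
  rw [isBlock_ofMask, h, testBit_line p q hp hq hpq, decide_eq_true_eq]

/-! ### Transpositions act as discrete Fourier transforms -/

/-- A permuted set of four points is a block of `p` if and only if the radical of the original set
is orthogonal to `p` with respect to the symplectic form of the transposition. -/
theorem radicalMask_swap : ∀ a : Fin 7, ∀ m ∈ quadMasks, ∀ n ∈ quadMasks,
    (Nat.ofBits fun i => m.testBit (Equiv.swap a.castSucc a.succ i)) = n → ∀ p : Vec,
    (radicalMask n).testBit p.bits = (radicalMask m &&& Nat.ofBits (n := 16) fun q =>
      !dot (polar a.castSucc a.succ p) (Vec.ofFin q)).beq (radicalMask m) := by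
  decide +kernel

theorem sum_chi_radicalMask : ∀ m ∈ quadMasks, ∀ x : Vec,
    (∑ q, if (radicalMask m).testBit q.bits then chi x q else 0) =
      if (radicalMask m &&& Nat.ofBits (n := 16) fun q => !dot x (Vec.ofFin q)).beq
        (radicalMask m) then 4 else 0 := by
  decide +kernel

theorem sum_chi : ∀ x : Vec, ∑ q, chi x q = if x = 0 then 16 else 0 := by
  decide +kernel

theorem polar_eq_zero : ∀ (a : Fin 7) (p : Vec), polar a.castSucc a.succ p = 0 ↔ p = 0 := by
  decide +kernel

theorem chi_zero (x : Vec) : chi x 0 = 1 := by revert x; decide +kernel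

/-- The transposition of neighbouring points `i` and `j` acts on the functions of the Steiner
systems by the Fourier transform with respect to the symplectic form `ω_i + ω_j`. -/
theorem steiner_swap (a : Fin 7) {S : Finset (Fin 8)} (hS : S.card = 4) (p : Vec) :
    4 * steiner p (S.map (Equiv.swap a.castSucc a.succ).toEmbedding) =
      ∑ q, chi (polar a.castSucc a.succ p) q * steiner q S := by
  obtain ⟨m, hm, hmS⟩ := exists_ofMask_eq_of_card hS
  obtain ⟨n, hn, hnS⟩ := exists_ofMask_eq_of_card
    (S := S.map (Equiv.swap a.castSucc a.succ).toEmbedding) (by rw [Finset.card_map, hS])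
  have hmn : (Nat.ofBits fun i => m.testBit (Equiv.swap a.castSucc a.succ i)) = n := by
    refine Nat.eq_of_testBit_eq fun i => ?_
    rcases lt_or_ge i 8 with hi | hi
    · rw [Nat.testBit_ofBits_lt _ _ hi, Bool.eq_iff_iff, ← mem_ofMask]
      have := mem_ofMask (m := n) (i := ⟨i, hi⟩)
      rw [hmS]
      rw [hnS, Finset.mem_map_equiv] at this
      rw [← this]
      simp
    · have hlt : n < 2 ^ i := by
        have : n < 256 := by
          simp only [quadMasks, List.mem_filter, List.mem_range] at hn
          exact hn.1
        exact this.trans_le (Nat.pow_le_pow_right (n := 2) (by norm_num) hi)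
      rw [Nat.testBit_ofBits_ge _ _ hi, Nat.testBit_lt_two_pow hlt]
  have hsum := sum_chi_radicalMask m hm (polar a.castSucc a.succ p)
  rw [← radicalMask_swap a m hm n hn hmn p] at hsum
  simp only [← isBlock_ofMask, hmS, hnS] at hsum
  have hterm (q : Vec) : chi (polar a.castSucc a.succ p) q * steiner q S =
      5 * (if IsBlock q S then chi (polar a.castSucc a.succ p) q else 0) -
        chi (polar a.castSucc a.succ p) q - if q = 0 then 4 else 0 := by
    by_cases hq : q = 0
    · subst hq
      simp [steiner, isBlock_zero, chi_zero]
    · by_cases h : IsBlock q S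
      · simp only [steiner, hq, h, if_true, if_false]
        ring
      · simp [steiner, hq, h]
  simp only [hterm, Finset.sum_sub_distrib, ← Finset.mul_sum, hsum, sum_chi, sum_ite_eq_zero_vec,
    polar_eq_zero]
  by_cases hp : p = 0
  · subst hp
    simp [steiner, isBlock_zero]
  · by_cases h : IsBlock p (S.map (Equiv.swap a.castSucc a.succ).toEmbedding) <;>
      simp [steiner, hp, h]

/-! ### Translations of the affine structures act as transvections -/

/-- For nonzero orthogonal `p` and `φ`, the pairs `i < j` with `ω_i p + ω_j p = φ` form a perfect
matching of the eight points: the pairs of points which differ by `φ` in the affine structure on the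
eight points defined by `i ↦ ω_i p`. -/
def matching (p φ : Vec) : List (Fin 8 × Fin 8) :=
  (List.finRange 8).flatMap fun i => ((List.finRange 8).filter fun j =>
    i < j ∧ polar i j p = φ).map fun j => (i, j)

theorem matching_spec : ∀ p φ : Vec, p ≠ 0 → φ ≠ 0 → dot φ p = false →
    (matching p φ).length = 4 ∧ (∀ i, ((matching p φ).map fun e =>
      (if e.1 = i then 1 else 0) + if e.2 = i then 1 else 0).sum = 1) ∧
      ∀ e ∈ matching p φ, e.1 ≠ e.2 := by
  decide +kernel

/-- The transvection `p ↦ p + (φ · p) v`. -/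
def transvection (v φ : Vec) : Vec →+ Vec where
  toFun p := p + if dot φ p then v else 0
  map_zero' := by revert v φ; decide +kernel
  map_add' p q := by
    rw [dot_add]
    cases dot φ p <;> cases dot φ q <;> simp
    · abel
    · abel
    · rw [← add_zero (p + q), ← Vec.add_self v]
      abel

theorem transvection_apply (v φ p : Vec) :
    transvection v φ p = p + if dot φ p then v else 0 := rfl

theorem transvection_involutive {v φ : Vec} (h : dot φ v = false) (p : Vec) :
    transvection v φ (transvection v φ p) = p := by
  rw [transvection_apply, transvection_apply, dot_add]
  cases hp : dot φ p
  · simp [dot_zero]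
  · simp only [if_true, h, Bool.xor_false, add_assoc, Vec.add_self, add_zero]

/-- The translation by `φ` of the affine structure of `v` on the eight points. -/
def translation (v φ : Vec) : Equiv.Perm (Fin 8) :=
  ((matching v φ).map fun e => Equiv.swap e.1 e.2).prod

/-- The translation by `φ` permutes the forms `ω_i` like the transvection does, up to a form which
does not depend on `i` and therefore cancels in a sum of four. Here this is stated on a basis. -/
theorem kerdock_translation_basis : ∀ v φ : Vec, v ≠ 0 → φ ≠ 0 → dot φ v = false →
    ∀ p ∈ ([1, 2, 4, 8] : List Vec), ∀ i : Fin 7,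
    kerdock (translation v φ i.succ) (transvection v φ p) + transvection φ v (kerdock i.succ p) =
      kerdock (translation v φ 0) (transvection v φ p) + transvection φ v (kerdock 0 p) := by
  decide +kernel

/-- The form `ω_i` as an additive map. -/
def kerdockHom (i : Fin 8) : Vec →+ Vec where
  toFun := kerdock i
  map_zero' := kerdock_zero i
  map_add' := kerdock_add i

theorem kerdock_translation {v φ : Vec} (hv : v ≠ 0) (hφ : φ ≠ 0) (h : dot φ v = false) (p : Vec)
    (i : Fin 8) :
    kerdock (translation v φ i) (transvection v φ p) + transvection φ v (kerdock i p) =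
      kerdock (translation v φ 0) (transvection v φ p) + transvection φ v (kerdock 0 p) := by
  induction i using Fin.cases with
  | zero => rfl
  | succ i =>
    have := Vec.addMonoidHom_ext
      (f := (kerdockHom (translation v φ i.succ)).comp (transvection v φ) +
        (transvection φ v).comp (kerdockHom i.succ))
      (g := (kerdockHom (translation v φ 0)).comp (transvection v φ) +
        (transvection φ v).comp (kerdockHom 0))
      (fun x hx => kerdock_translation_basis v φ hv hφ h x hx i)
    exact DFunLike.congr_fun this p

theorem sign_translation {v φ : Vec} (hv : v ≠ 0) (hφ : φ ≠ 0) (h : dot φ v = false) :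
    Equiv.Perm.sign (translation v φ) = 1 := by
  obtain ⟨hl, -, hne⟩ := matching_spec v φ hv hφ h
  have aux : ∀ l : List (Fin 8 × Fin 8), (∀ e ∈ l, e.1 ≠ e.2) →
      Equiv.Perm.sign (l.map fun e => Equiv.swap e.1 e.2).prod = (-1) ^ l.length := by
    intro l
    induction l with
    | nil => simp
    | cons e l ih =>
      intro hl
      rw [List.map_cons, List.prod_cons, map_mul, ih fun x hx => hl x (List.mem_cons_of_mem _ hx),
        Equiv.Perm.sign_swap (hl e List.mem_cons_self), List.length_cons, pow_succ']
  rw [translation, aux _ hne, hl]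
  rfl

theorem isBlock_translation {v φ : Vec} (hv : v ≠ 0) (hφ : φ ≠ 0) (h : dot φ v = false)
    {S : Finset (Fin 8)} (hS : S.card = 4) (p : Vec) :
    IsBlock (transvection v φ p) (S.map (translation v φ).toEmbedding) ↔ IsBlock p S := by
  have h' : dot v φ = false := by rw [dot_comm, h]
  have key : ∑ i ∈ S, kerdock (translation v φ i) (transvection v φ p) =
      transvection φ v (∑ i ∈ S, kerdock i p) := by
    rw [map_sum, ← Vec.add_eq_zero_iff, ← Finset.sum_add_distrib,
      Finset.sum_congr rfl fun i _ => kerdock_translation hv hφ h p i, Finset.sum_const, hS]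
    simp only [succ_nsmul, zero_nsmul, zero_add, Vec.add_self]
  rw [IsBlock, Finset.sum_map, IsBlock]
  simp only [Equiv.coe_toEmbedding]
  rw [key]
  refine ⟨fun hz => ?_, fun hz => by rw [hz, map_zero]⟩
  rw [← transvection_involutive h' (∑ i ∈ S, kerdock i p), hz, map_zero]

theorem steiner_translation {v φ : Vec} (hv : v ≠ 0) (hφ : φ ≠ 0) (h : dot φ v = false)
    {S : Finset (Fin 8)} (hS : S.card = 4) (p : Vec) :
    steiner p (S.map (translation v φ).symm.toEmbedding) = steiner (transvection v φ p) S := by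
  have hb := isBlock_translation hv hφ h (S := S.map (translation v φ).symm.toEmbedding)
    (by rw [Finset.card_map, hS]) p
  have hSS : (S.map (translation v φ).symm.toEmbedding).map (translation v φ).toEmbedding = S := by
    ext i
    simp [Finset.mem_map_equiv]
  rw [hSS] at hb
  have hp : transvection v φ p = 0 ↔ p = 0 := by
    refine ⟨fun hz => ?_, fun hz => by rw [hz, map_zero]⟩
    rw [← transvection_involutive h p, hz, map_zero]
  simp only [steiner, hp, hb]

/-! ### The Steiner systems as sums of products of brackets -/

/-- Bitmask version of `sum_matching`. -/
theorem bracket_radicalMask : ∀ p : Vec, p ≠ 0 → ∀ m ∈ quadMasks,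
    ∑ φ, (if φ = 0 ∨ dot φ p then 0 else
      (if ((matching p φ).map fun e => kerdock e.1 p).sum = 0 then 1 else -1) *
        ((matching p φ).map fun e =>
          (m.testBit e.1).toInt - (m.testBit e.2).toInt).prod) =
      if (radicalMask m).testBit p.bits then 4 else -1 := by
  decide +kernel

/-- The signed matchings of `p` combine to the function of the Steiner system of `p`: the product of
the brackets of a matching has the value `±1` on its transversals and `0` on the other sets. -/
theorem sum_matching {p : Vec} (hp : p ≠ 0) {S : Finset (Fin 8)} (hS : S.card = 4) :
    ∑ φ, (if φ = 0 ∨ dot φ p then 0 else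
      (if ((matching p φ).map fun e => kerdock e.1 p).sum = 0 then 1 else -1) *
        ((matching p φ).map fun e =>
          (if e.1 ∈ S then (1 : ℤ) else 0) - if e.2 ∈ S then 1 else 0).prod) = steiner p S := by
  obtain ⟨m, hm, rfl⟩ := exists_ofMask_eq_of_card hS
  have h (b : Bool) : (if b then (1 : ℤ) else 0) = b.toInt := by cases b <;> rfl
  rw [steiner_ofMask, if_neg hp, ← bracket_radicalMask p hp m hm]
  simp only [mem_ofMask, h]

/-! ### Multilinear forms and their values at coordinate points -/

section Vertex

variable {k : Type*} [Field k] {n : ℕ}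

/-- The index of the nonzero coordinate of the `i`-th point in the configuration attached to `S`. -/
def vertexIndex (S : Finset (Fin n)) (i : Fin n) : Fin 2 := if i ∈ S then 0 else 1

/-- Evaluation at the configuration whose `i`-th point is `(1, 0)` for `i ∈ S` and `(0, 1)` for
`i ∉ S`. -/
noncomputable def evalVertex (k : Type*) [Field k] {n : ℕ} (S : Finset (Fin n)) :
    MvPolynomial (Fin n × Fin 2) k →ₐ[k] k :=
  aeval fun q => if q.2 = vertexIndex S q.1 then 1 else 0

/-- The multilinear monomial which takes the value `1` at the configuration attached to `S`. -/
noncomputable def vertexMonomial (k : Type*) [Field k] {n : ℕ} (S : Finset (Fin n)) :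
    MvPolynomial (Fin n × Fin 2) k :=
  ∏ i, X (i, vertexIndex S i)

theorem vertexIndex_eq_iff {S T : Finset (Fin n)} {i : Fin n} :
    vertexIndex S i = vertexIndex T i ↔ (i ∈ S ↔ i ∈ T) := by
  by_cases h : i ∈ S <;> by_cases h' : i ∈ T <;> simp [vertexIndex, h, h']

theorem evalVertex_vertexMonomial (S T : Finset (Fin n)) :
    evalVertex k T (vertexMonomial k S) = if S = T then 1 else 0 := by
  simp only [evalVertex, vertexMonomial, map_prod, aeval_X, Finset.prod_ite_zero,
    Finset.prod_const_one, vertexIndex_eq_iff, Finset.mem_univ, true_imp_iff, ← Finset.ext_iff]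

theorem evalVertex_rename (σ : Equiv.Perm (Fin n)) (S : Finset (Fin n))
    (p : MvPolynomial (Fin n × Fin 2) k) :
    evalVertex k S (rename (Prod.map σ id) p) = evalVertex k (S.map σ.symm.toEmbedding) p := by
  rw [evalVertex, aeval_rename, evalVertex]
  congr 2
  ext q
  by_cases h : σ q.1 ∈ S <;> simp [vertexIndex, Finset.mem_map_equiv, h]

/-- A form which is linear in the coordinates of each point is the combination of the multilinear
monomials given by its values at the coordinate configurations. -/
theorem sum_evalVertex_mul {p : MvPolynomial (Fin n × Fin 2) k}
    (hp : ∀ i : Fin n,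
      IsWeightedHomogeneous (fun q : Fin n × Fin 2 => if q.1 = i then 1 else 0) p 1) :
    p = ∑ S, C (evalVertex k S p) * vertexMonomial k S := by
  have hmon : ∀ m ∈ p.support,
      ∃ S, monomial m (p.coeff m) = C (p.coeff m) * vertexMonomial k S := by
    intro m hm
    have hw (i : Fin n) : m (i, 0) + m (i, 1) = 1 := by
      have h := hp i (mem_support_iff.mp hm)
      rw [Finsupp.weight_apply, Finsupp.sum_fintype _ _ (by simp), Fintype.sum_prod_type,
        Finset.sum_eq_single i (fun j _ hj => by simp [hj]) (by simp)] at h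
      simpa using h
    refine ⟨Finset.univ.filter fun i => m (i, 0) = 1, ?_⟩
    have hX : vertexMonomial k (Finset.univ.filter fun i => m (i, 0) = 1) =
        monomial (∑ i,
          Finsupp.single (i, vertexIndex (Finset.univ.filter fun i => m (i, 0) = 1) i) 1) 1 := by
      rw [vertexMonomial, monomial_sum_one]
      rfl
    rw [hX, C_mul_monomial, mul_one]
    refine congrArg (fun u => monomial u (p.coeff m)) (Finsupp.ext fun q => ?_)
    obtain ⟨j, b⟩ := q
    simp only [Finsupp.finsetSum_apply, Finsupp.single_apply, Prod.mk.injEq]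
    rw [Finset.sum_eq_single j (fun i _ hi => by simp [hi]) (by simp)]
    have := hw j
    simp only [vertexIndex, Finset.mem_filter, Finset.mem_univ, true_and]
    fin_cases b <;> by_cases hj : m (j, 0) = 1 <;> simp [hj] <;> omega
  conv_lhs => rw [p.as_sum]
  conv_rhs => rw [p.as_sum]
  simp only [map_sum, Finset.sum_mul]
  rw [Finset.sum_comm]
  refine Finset.sum_congr rfl fun m hm => ?_
  obtain ⟨S, hS⟩ := hmon m hm
  rw [hS]
  simp only [map_mul, evalVertex_vertexMonomial, algHom_C, Algebra.algebraMap_self,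
    RingHom.id_apply]
  rw [Finset.sum_eq_single S (fun T _ hT => by simp [hT.symm]) (by simp)]
  simp

theorem evalVertex_subst (g : Matrix (Fin 2) (Fin 2) k) (T : Finset (Fin n))
    {p : MvPolynomial (Fin n × Fin 2) k}
    (hp : ∀ i : Fin n,
      IsWeightedHomogeneous (fun q : Fin n × Fin 2 => if q.1 = i then 1 else 0) p 1) :
    evalVertex k T (subst k n g p) =
      ∑ S, evalVertex k S p * ∏ i, g (vertexIndex S i) (vertexIndex T i) := by
  conv_lhs => rw [sum_evalVertex_mul hp]
  simp only [map_sum, map_mul, algHom_C, AlgHom.commutes, Algebra.algebraMap_self, RingHom.id_apply]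
  refine Finset.sum_congr rfl fun S _ => ?_
  congr 1
  rw [vertexMonomial, map_prod, map_prod]
  refine Finset.prod_congr rfl fun i _ => ?_
  have hb (b : Fin 2) : (if 0 = b then g (vertexIndex S i) 0 else 0) +
      (if 1 = b then g (vertexIndex S i) 1 else 0) = g (vertexIndex S i) b := by
    fin_cases b <;> simp
  simpa [subst, evalVertex] using hb _

theorem ext_evalVertex {p q : invariantForms k n 1}
    (h : ∀ S, evalVertex k S p.1 = evalVertex k S q.1) : p = q := by
  apply Subtype.ext
  rw [sum_evalVertex_mul p.2.1, sum_evalVertex_mul q.2.1]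
  simp only [h]

/-- Invariance under the unipotent matrix `x ↦ x + y`. -/
theorem sum_superset_evalVertex (p : invariantForms k n 1) (T : Finset (Fin n)) :
    ∑ S, (if T ⊆ S then evalVertex k S p.1 else 0) = evalVertex k T p.1 := by
  have hg := p.2.2 ⟨!![1, 1; 0, 1], by simp [Matrix.det_fin_two]⟩
  conv_rhs => rw [← hg, evalVertex_subst _ _ p.2.1]
  refine Finset.sum_congr rfl fun S _ => ?_
  have : ∏ i, (!![1, 1; 0, 1] : Matrix (Fin 2) (Fin 2) k) (vertexIndex S i) (vertexIndex T i) =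
      if T ⊆ S then 1 else 0 := by
    have hi (i : Fin n) : (!![1, 1; 0, 1] : Matrix (Fin 2) (Fin 2) k) (vertexIndex S i)
        (vertexIndex T i) = if i ∈ T → i ∈ S then 1 else 0 := by
      by_cases h : i ∈ S <;> by_cases h' : i ∈ T <;> simp [vertexIndex, h, h']
    simp only [hi, Finset.prod_ite_zero, Finset.prod_const_one, Finset.mem_univ, true_imp_iff,
      Finset.subset_iff]
  rw [this]
  simp

/-- Invariance under the torus, used for the single element `diag(2, 1/2)`. -/
theorem evalVertex_eq_zero [CharZero k] (p : invariantForms k n 1) {T : Finset (Fin n)}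
    (hT : T.card + T.card ≠ n) : evalVertex k T p.1 = 0 := by
  have hg := p.2.2 ⟨!![2, 0; 0, 2⁻¹], by simp [Matrix.det_fin_two]⟩
  have h := evalVertex_subst (!![2, 0; 0, 2⁻¹] : Matrix (Fin 2) (Fin 2) k) T p.2.1
  rw [hg, Finset.sum_eq_single T] at h
  · have hprod : ∏ i, (!![2, 0; 0, 2⁻¹] : Matrix (Fin 2) (Fin 2) k) (vertexIndex T i)
        (vertexIndex T i) = 2 ^ T.card * (2⁻¹) ^ (n - T.card) := by
      have hi (i : Fin n) : (!![2, 0; 0, 2⁻¹] : Matrix (Fin 2) (Fin 2) k) (vertexIndex T i)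
          (vertexIndex T i) = if i ∈ T then 2 else 2⁻¹ := by
        by_cases h' : i ∈ T <;> simp [vertexIndex, h']
      simp only [hi, Finset.prod_ite, Finset.prod_const]
      congr 2
      · simp
      · rw [Finset.filter_not, Finset.card_sdiff_of_subset (Finset.filter_subset _ _)]
        simp
    rw [hprod, inv_pow] at h
    by_contra hne
    have h1 : (2 : k) ^ T.card * (2 ^ (n - T.card))⁻¹ = 1 :=
      mul_left_cancel₀ hne (by rw [mul_one]; exact h.symm)
    rw [mul_inv_eq_one₀ (pow_ne_zero _ two_ne_zero)] at h1
    have h2 : (2 : ℕ) ^ T.card = 2 ^ (n - T.card) := by exact_mod_cast h1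
    have h3 := Nat.pow_right_injective le_rfl h2
    have h4 : T.card ≤ n := by simpa using T.card_le_univ
    omega
  · intro S _ hS
    obtain ⟨i, hi⟩ : ∃ i, ¬ (i ∈ S ↔ i ∈ T) := by
      by_contra! hcon
      exact hS (Finset.ext hcon)
    rw [Finset.prod_eq_zero (Finset.mem_univ i), mul_zero]
    by_cases h : i ∈ S <;> by_cases h' : i ∈ T <;> simp_all [vertexIndex]
  · simp

/-- Weighting the value at `T` by the number of `t`-element subsets of `S ∩ T` gives the sum of the
values at the `t`-element subsets of `S`. -/
theorem sum_choose_card_inter (p : invariantForms k n 1) (S : Finset (Fin n)) (t : ℕ) :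
    ∑ T, ((S ∩ T).card.choose t : k) * evalVertex k T p.1 =
      ∑ A ∈ Finset.powersetCard t S, evalVertex k A p.1 := by
  rw [← Finset.sum_congr rfl fun A _ => sum_superset_evalVertex p A, Finset.sum_comm]
  refine Finset.sum_congr rfl fun T _ => ?_
  rw [← Finset.sum_filter, Finset.sum_const, nsmul_eq_mul, ← Finset.card_powersetCard]
  congr 3
  ext A
  simp only [Finset.mem_powersetCard, Finset.mem_filter, Finset.subset_inter_iff]
  tauto

end Vertex

/-! ### Fifteen invariant forms which span `R₁` -/

section Span

variable {k : Type*} [Field k]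

/-- The bracket `x_i y_j - x_j y_i`. -/
noncomputable def bracket (k : Type*) [Field k] (e : Fin 8 × Fin 8) :
    MvPolynomial (Fin 8 × Fin 2) k :=
  X (e.1, 0) * X (e.2, 1) - X (e.2, 0) * X (e.1, 1)

theorem subst_bracket (g : Matrix.SpecialLinearGroup (Fin 2) k) (e : Fin 8 × Fin 8) :
    subst k 8 g.1 (bracket k e) = bracket k e := by
  have hdet : (C (g.1 0 0) * C (g.1 1 1) - C (g.1 0 1) * C (g.1 1 0) :
      MvPolynomial (Fin 8 × Fin 2) k) = 1 := by
    rw [← C_mul, ← C_mul, ← C_sub, ← Matrix.det_fin_two, g.2, C_1]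
  simp only [bracket, subst, map_sub, map_mul, aeval_X, Fin.sum_univ_two]
  linear_combination (X (e.1, 0) * X (e.2, 1) - X (e.2, 0) * X (e.1, 1)) * hdet

theorem isWeightedHomogeneous_bracket (i : Fin 8) (e : Fin 8 × Fin 8) :
    IsWeightedHomogeneous (fun q : Fin 8 × Fin 2 => if q.1 = i then 1 else 0) (bracket k e)
      ((if e.1 = i then 1 else 0) + if e.2 = i then 1 else 0) := by
  refine IsWeightedHomogeneous.sub ?_ ?_
  · exact (isWeightedHomogeneous_X k _ _).mul (isWeightedHomogeneous_X k _ _)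
  · rw [add_comm]
    exact (isWeightedHomogeneous_X k _ _).mul (isWeightedHomogeneous_X k _ _)

theorem prod_bracket_mem {l : List (Fin 8 × Fin 8)}
    (hl : ∀ i, (l.map fun e => (if e.1 = i then 1 else 0) + if e.2 = i then 1 else 0).sum = 1) :
    (l.map (bracket k)).prod ∈ R₁ k := by
  refine ⟨fun i => ?_, fun g => ?_⟩
  · have key (l : List (Fin 8 × Fin 8)) :
        IsWeightedHomogeneous (fun q : Fin 8 × Fin 2 => if q.1 = i then 1 else 0)
          (l.map (bracket k)).prod
          (l.map fun e => (if e.1 = i then 1 else 0) + if e.2 = i then 1 else 0).sum := by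
      induction l with
      | nil => exact isWeightedHomogeneous_one k _
      | cons e l ih =>
        simp only [List.map_cons, List.prod_cons, List.sum_cons]
        exact (isWeightedHomogeneous_bracket i e).mul ih
    simpa only [hl i] using key l
  · rw [map_list_prod, List.map_map]
    congr 2
    ext1 e
    exact subst_bracket g e

theorem evalVertex_bracket (S : Finset (Fin 8)) (e : Fin 8 × Fin 8) :
    evalVertex k S (bracket k e) =
      (((if e.1 ∈ S then (1 : ℤ) else 0) - if e.2 ∈ S then 1 else 0 : ℤ) : k) := by
  by_cases h : e.1 ∈ S <;> by_cases h' : e.2 ∈ S <;>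
    simp [evalVertex, bracket, vertexIndex, h, h']

/-- The invariant form `z_p` attached to the Steiner system of `p`: a signed sum of the products of
brackets of the seven matchings of `p`. The vector `0` gives the form `0`. -/
noncomputable def steinerForm (k : Type*) [Field k] (p : Vec) : R₁ k where
  val := if p = 0 then 0 else ∑ φ, if φ = 0 ∨ dot φ p then 0 else
    ((if ((matching p φ).map fun e => kerdock e.1 p).sum = 0 then 1 else -1 : ℤ) : k) •
      ((matching p φ).map (bracket k)).prod
  property := by
    split_ifs with hp
    · exact zero_mem _
    · refine Submodule.sum_mem _ fun φ _ => ?_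
      split_ifs with hφ
      · exact zero_mem _
      all_goals
        push Not at hφ
        exact Submodule.smul_mem _ _ (prod_bracket_mem
          (matching_spec p φ hp hφ.1 (by simpa using hφ.2)).2.1)

theorem steinerForm_zero : steinerForm k 0 = 0 := by
  ext1
  simp [steinerForm]

theorem evalVertex_steinerForm (p : Vec) {S : Finset (Fin 8)} (hS : S.card = 4) :
    evalVertex k S (steinerForm k p).1 = (steiner p S : k) := by
  by_cases hp : p = 0
  · simp [hp, steinerForm_zero, steiner]
  · rw [← sum_matching hp hS]
    simp only [steinerForm, hp, if_false, map_sum, Int.cast_sum]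
    refine Finset.sum_congr rfl fun φ _ => ?_
    by_cases hφ : φ = 0 ∨ dot φ p = true
    · simp [hφ]
    · rw [if_neg hφ, if_neg hφ, map_smul, smul_eq_mul, Int.cast_mul, map_list_prod, List.map_map]
      congr 1
      have : (Int.cast : ℤ → k) = Int.castRingHom k := rfl
      rw [this, map_list_prod, List.map_map]
      congr 2
      ext1 e
      exact evalVertex_bracket S e

variable [CharZero k]

/-- Invariant forms in `R₁` are determined by their values at the `70` balanced coordinate
configurations. -/
theorem R₁_ext {p q : R₁ k}
    (h : ∀ S : Finset (Fin 8), S.card = 4 → evalVertex k S p.1 = evalVertex k S q.1) : p = q := by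
  refine ext_evalVertex fun S => ?_
  by_cases hS : S.card = 4
  · exact h S hS
  · rw [evalVertex_eq_zero p (by omega), evalVertex_eq_zero q (by omega)]

theorem sum_steiner {S : Finset (Fin 8)} (hS : S.card = 4) : ∑ p, steiner p S = 0 := by
  have h (p : Vec) : steiner p S =
      5 * (if IsBlock p S ∧ IsBlock p S then (1 : ℤ) else 0) - 1 - if p = 0 then 4 else 0 := by
    by_cases hp : p = 0
    · subst hp
      simp [steiner, isBlock_zero]
    · by_cases h : IsBlock p S <;> simp [steiner, hp, h]
  simp only [h, Finset.sum_sub_distrib, ← Finset.mul_sum, card_isBlock_and hS hS,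
    sum_ite_eq_zero_vec, Finset.inter_self, hS, Finset.sum_const, Finset.card_univ, Vec.card_eq]
  have he4 : Even 4 := ⟨2, rfl⟩
  simp [he4]

theorem sum_steinerForm : ∑ p, steinerForm k p = 0 := by
  refine R₁_ext fun S hS => ?_
  simp only [AddSubmonoidClass.coe_finsetSum, map_sum, evalVertex_steinerForm _ hS]
  rw [← Int.cast_sum, sum_steiner hS]
  simp

/-- The forms `z_p` span `R₁`. -/
theorem exists_eq_sum_steinerForm (f : R₁ k) :
    ∃ c : Vec → k, f = ∑ p, c p • steinerForm k p := by
  -- The coefficient of `z_p` is the sum of the values of `f` over the blocks of `p`, up to a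
  -- scalar; `300 = 5 * 60` is the leading coefficient of the kernel in the binomial basis.
  refine ⟨fun p => 300⁻¹ * ∑ T, ((steiner p T : k) + 1) * evalVertex k T f.1,
    R₁_ext fun S hS => ?_⟩
  have hlow (t : ℕ) (ht : t < 4) : ∑ T, ((S ∩ T).card.choose t : k) * evalVertex k T f.1 = 0 := by
    rw [sum_choose_card_inter]
    refine Finset.sum_eq_zero fun A hA => evalVertex_eq_zero f ?_
    have := (Finset.mem_powersetCard.mp hA).2
    omega
  have htop : ∑ T, ((S ∩ T).card.choose 4 : k) * evalVertex k T f.1 = evalVertex k S f.1 := by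
    rw [sum_choose_card_inter, ← hS, Finset.powersetCard_self, Finset.sum_singleton]
  have h0 : ∑ T, evalVertex k T f.1 = 0 := by simpa using hlow 0 (by norm_num)
  have hker (T : Finset (Fin 8)) :
      (∑ p, (steiner p S : k) * ((steiner p T : k) + 1)) * evalVertex k T f.1 =
        60 * evalVertex k T f.1 - 75 * (((S ∩ T).card.choose 1 : k) * evalVertex k T f.1) +
        100 * (((S ∩ T).card.choose 2 : k) * evalVertex k T f.1) -
        150 * (((S ∩ T).card.choose 3 : k) * evalVertex k T f.1) +
        300 * (((S ∩ T).card.choose 4 : k) * evalVertex k T f.1) := by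
    by_cases hT : T.card = 4
    · have := congrArg (Int.cast : ℤ → k) (sum_steiner_mul_steiner hS hT)
      push_cast at this
      rw [this]
      ring
    · rw [evalVertex_eq_zero f (by omega)]
      ring
  have hmain : ∑ T, (∑ p, (steiner p S : k) * ((steiner p T : k) + 1)) * evalVertex k T f.1 =
      300 * evalVertex k S f.1 := by
    simp only [hker, Finset.sum_add_distrib, Finset.sum_sub_distrib, ← Finset.mul_sum, h0, htop,
      hlow 1 (by norm_num), hlow 2 (by norm_num), hlow 3 (by norm_num)]
    ring
  have h300 : (300 : k) ≠ 0 := by norm_num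
  simp only [AddSubmonoidClass.coe_finsetSum, Submodule.coe_smul, map_sum, map_smul,
    evalVertex_steinerForm _ hS, smul_eq_mul]
  rw [← mul_right_inj' h300, ← hmain]
  simp only [Finset.sum_mul, Finset.mul_sum]
  rw [Finset.sum_comm]
  refine Finset.sum_congr rfl fun p _ => Finset.sum_congr rfl fun T _ => ?_
  field_simp

end Span

/-! ### A basis of `R₁` and the action of permutations -/

section Basis

variable {k : Type*} [Field k]

theorem Vec.sum_univ {M : Type*} [AddCommMonoid M] (f : Vec → M) :
    ∑ p, f p = f 0 + (∑ i : Fin 14, f (Vec.ofFin i.castSucc.succ) + f 15) := by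
  refine (Fin.sum_univ_succ (n := 15) f).trans ?_
  rw [Fin.sum_univ_castSucc]
  rfl

theorem Vec.sum_add_left {M : Type*} [AddCommMonoid M] (p : Vec) (f : Vec → M) :
    ∑ q, f (p + q) = ∑ q, f q :=
  Fintype.sum_equiv (Equiv.addLeft p) _ _ fun _ => rfl

theorem evalVertex_permRep (σ : Equiv.Perm (Fin 8)) (S : Finset (Fin 8)) (f : R₁ k) :
    evalVertex k S (permRep k 8 1 σ f).1 = evalVertex k (S.map σ.symm.toEmbedding) f.1 :=
  evalVertex_rename σ S f.1

variable [CharZero k]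

/-- The only relation between the nonzero forms `z_p` is that their sum vanishes. -/
theorem sum_smul_steinerForm_eq_zero {a : Vec → k} (ha : a 0 = 0)
    (h : ∑ p, a p • steinerForm k p = 0) {p : Vec} (hp : p ≠ 0) : 15 * a p = ∑ q, a q := by
  -- Evaluation at a set of four points which is a block for the line through `p` and `q`. These
  -- equations are then summed over the lines through `p`.
  have hline (q : Vec) (hq : q ≠ 0) (hpq : q ≠ p) :
      5 * (a p + a q + a (p + q)) = ∑ r, a r := by
    obtain ⟨S, hS, hb⟩ := exists_isBlock_iff hp hq hpq.symm
    have hpq0 : p + q ≠ 0 := fun h0 => hpq (Vec.add_eq_zero_iff.mp h0).symm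
    have hpqp : p + q ≠ p := fun h0 => hq (by simpa using h0)
    have hpqq : p + q ≠ q := fun h0 => hp (by simpa using h0)
    have hev := congrArg (fun f : R₁ k => evalVertex k S f.1) h
    simp only [AddSubmonoidClass.coe_finsetSum, Submodule.coe_smul, map_sum, map_smul,
      evalVertex_steinerForm _ hS, smul_eq_mul, ZeroMemClass.coe_zero, map_zero] at hev
    have hterm (r : Vec) : a r * (steiner r S : k) =
        5 * (if r = p then a p else 0) + 5 * (if r = q then a q else 0) +
          5 * (if r = p + q then a (p + q) else 0) - a r := by
      by_cases h0 : r = 0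
      · subst h0
        simp [steiner, ha, hp.symm, hq.symm, hpq0.symm]
      by_cases h1 : r = p
      · subst h1
        simp [steiner, hb, hp, hpq.symm, hpqp.symm]
        ring
      by_cases h2 : r = q
      · subst h2
        simp [steiner, hb, hq, hpq, hpqq.symm]
        ring
      by_cases h3 : r = p + q
      · subst h3
        simp only [steiner, hb, hpq0, hpqp, hpqq]
        simp
        ring
      · simp [steiner, hb, h0, h1, h2, h3]
    simp only [hterm, Finset.sum_sub_distrib, Finset.sum_add_distrib, ← Finset.mul_sum,
      Finset.sum_ite_eq', Finset.mem_univ, if_true] at hev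
    linear_combination hev
  have hall (q : Vec) : 5 * (a p + a q + a (p + q)) = (∑ r, a r) +
      (if q = 0 then 10 * a p - ∑ r, a r else 0) + if q = p then 10 * a p - ∑ r, a r else 0 := by
    by_cases h0 : q = 0
    · subst h0
      simp only [ha, hp.symm, add_zero, if_true, if_false]
      ring
    by_cases h1 : q = p
    · subst h1
      simp only [ha, hp, Vec.add_self, add_zero, if_true, if_false]
      ring
    · simp [hline q h0 h1, h0, h1]
  have hsum := Finset.sum_congr (rfl : (Finset.univ : Finset Vec) = _) fun q _ => hall q
  simp only [← Finset.mul_sum, Finset.sum_add_distrib, Vec.sum_add_left, Finset.sum_ite_eq',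
    Finset.mem_univ, if_true, Finset.sum_const, Finset.card_univ, Vec.card_eq, nsmul_eq_mul] at hsum
  push_cast at hsum
  linear_combination hsum / 4

/-- The basis of `R₁` formed by fourteen of the forms `z_p`. -/
noncomputable def steinerBasis (k : Type*) [Field k] [CharZero k] :
    Module.Basis (Fin 14) k (R₁ k) :=
  Module.Basis.mk (v := fun i => steinerForm k (Vec.ofFin i.castSucc.succ))
    (by
      rw [Fintype.linearIndependent_iff]
      intro g hg i
      let a : Vec → k := (Fin.cons 0 (Fin.snoc g 0 : Fin 15 → k) : Fin 16 → k)
      have hai (i : Fin 14) : a (Vec.ofFin i.castSucc.succ) = g i := by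
        simp [a, Vec.ofFin]
      have ha0 : a 0 = 0 := rfl
      have ha15 : a 15 = 0 := by
        change (Fin.cons 0 (Fin.snoc g 0 : Fin 15 → k) : Fin 16 → k) (Fin.last 14).succ = 0
        rw [Fin.cons_succ, Fin.snoc_last]
      have h : ∑ p, a p • steinerForm k p = 0 := by
        rw [Vec.sum_univ]
        simp only [hai, ha0, ha15, zero_smul, add_zero, zero_add]
        exact hg
      have h15 := sum_smul_steinerForm_eq_zero ha0 h (p := 15) (by decide)
      have hi := sum_smul_steinerForm_eq_zero ha0 h (p := Vec.ofFin i.castSucc.succ)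
        (by revert i; decide)
      rw [← h15, ha15, mul_zero, hai] at hi
      simpa using hi)
    (by
      rintro f -
      obtain ⟨c, rfl⟩ := exists_eq_sum_steinerForm f
      have h15 : steinerForm k 15 =
          -∑ i : Fin 14, steinerForm k (Vec.ofFin i.castSucc.succ) := by
        have h := sum_steinerForm (k := k)
        rw [Vec.sum_univ, steinerForm_zero, zero_add] at h
        exact eq_neg_of_add_eq_zero_right h
      have hmem (i : Fin 14) : steinerForm k (Vec.ofFin i.castSucc.succ) ∈ Submodule.span k
          (Set.range fun i : Fin 14 => steinerForm k (Vec.ofFin i.castSucc.succ)) :=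
        Submodule.subset_span ⟨i, rfl⟩
      rw [Vec.sum_univ, steinerForm_zero, smul_zero, zero_add, h15]
      exact Submodule.add_mem _ (Submodule.sum_mem _ fun i _ => Submodule.smul_mem _ _ (hmem i))
        (Submodule.smul_mem _ _ (Submodule.neg_mem _ (Submodule.sum_mem _ fun i _ => hmem i))))

theorem finrank_R₁ : Module.finrank k (R₁ k) = 14 := by
  rw [Module.finrank_eq_card_basis (steinerBasis k), Fintype.card_fin]

/-- The values of a linear form at the `z_p` can be prescribed arbitrarily, subject to the relation
`∑ p, z_p = 0`. -/
theorem exists_dual_steinerForm {u : Vec → k} (hu : u 0 = 0) (hsum : ∑ p, u p = 0) :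
    ∃ l : R₁ k →ₗ[k] k, ∀ p, l (steinerForm k p) = u p := by
  let l := (steinerBasis k).constr k fun i => u (Vec.ofFin i.castSucc.succ)
  have hl (i : Fin 14) : l (steinerForm k (Vec.ofFin i.castSucc.succ)) =
      u (Vec.ofFin i.castSucc.succ) := by
    have := (steinerBasis k).constr_basis k (fun i => u (Vec.ofFin i.castSucc.succ)) i
    rwa [steinerBasis, Module.Basis.mk_apply] at this
  refine ⟨l, fun p => ?_⟩
  have hp : p = 0 ∨ p = 15 ∨ ∃ i : Fin 14, p = Vec.ofFin i.castSucc.succ := by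
    revert p
    decide +kernel
  obtain rfl | rfl | ⟨i, rfl⟩ := hp
  · rw [steinerForm_zero, map_zero, hu]
  · have h := congrArg l (sum_steinerForm (k := k))
    rw [Vec.sum_univ, steinerForm_zero, zero_add, map_add, map_sum, map_zero] at h
    simp only [hl] at h
    rw [Vec.sum_univ, hu, zero_add, ← h] at hsum
    exact (add_left_cancel hsum).symm
  · exact hl i

theorem permRep_swap_steinerForm (a : Fin 7) (p : Vec) :
    permRep k 8 1 (Equiv.swap a.castSucc a.succ) (steinerForm k p) =
      (4⁻¹ : k) • ∑ q, (chi (polar a.castSucc a.succ p) q : k) • steinerForm k q := by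
  refine R₁_ext fun S hS => ?_
  have h := congrArg (Int.cast : ℤ → k) (steiner_swap a hS p)
  push_cast at h
  rw [evalVertex_permRep, evalVertex_steinerForm _ (by rw [Finset.card_map, hS]),
    Equiv.symm_swap]
  simp only [AddSubmonoidClass.coe_finsetSum, Submodule.coe_smul, map_sum, map_smul,
    evalVertex_steinerForm _ hS, smul_eq_mul, ← h]
  rw [inv_mul_cancel_left₀ (by norm_num)]

theorem permRep_translation_steinerForm {v φ : Vec} (hv : v ≠ 0) (hφ : φ ≠ 0)
    (h : dot φ v = false) (p : Vec) :
    permRep k 8 1 (translation v φ) (steinerForm k p) = steinerForm k (transvection v φ p) := by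
  refine R₁_ext fun S hS => ?_
  rw [evalVertex_permRep, evalVertex_steinerForm _ (by rw [Finset.card_map, hS]),
    steiner_translation hv hφ h hS, evalVertex_steinerForm _ hS]

end Basis

/-! ### Linear algebra of the annihilator -/

section Annihilator

variable {k : Type*} [Field k]

/-- For a matrix `a`, the cubic form `∑ p, (a u)_p (4 u_p² - ∑ r, u_r u_{p + r})`, with its three
arguments separated. -/
def annihilatorForm (a : Vec → Vec → k) (x y w : Vec → k) : k :=
  ∑ p, (∑ q, a p q * x q) * (4 * (y p * w p) - ∑ r, y r * w (p + r))

variable (a : Vec → Vec → k) (x x' y y' w w' : Vec → k)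

theorem annihilatorForm_add_left :
    annihilatorForm a (x + x') y w = annihilatorForm a x y w + annihilatorForm a x' y w := by
  simp only [annihilatorForm, Pi.add_apply, mul_add, add_mul, Finset.sum_add_distrib]

theorem annihilatorForm_add_right :
    annihilatorForm a x y (w + w') = annihilatorForm a x y w + annihilatorForm a x y w' := by
  simp only [annihilatorForm, ← Finset.sum_add_distrib]
  refine Finset.sum_congr rfl fun p _ => ?_
  simp only [Pi.add_apply, mul_add, Finset.sum_add_distrib]
  ring

theorem annihilatorForm_comm : annihilatorForm a x y w = annihilatorForm a x w y := by
  refine Finset.sum_congr rfl fun p _ => ?_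
  rw [mul_comm (y p), ← Vec.sum_add_left p fun r => y r * w (p + r)]
  simp only [Vec.add_add_cancel, mul_comm (y _)]

theorem annihilatorForm_add_middle :
    annihilatorForm a x (y + y') w = annihilatorForm a x y w + annihilatorForm a x y' w := by
  simp only [annihilatorForm_comm a x _ w, annihilatorForm_add_right]

/-- The symmetric trilinear form which polarizes the cubic form of a matrix; its diagonal is three
times the cubic form. -/
def polarForm : k := annihilatorForm a x y w + annihilatorForm a y x w + annihilatorForm a w x y

theorem polarForm_swap_left : polarForm a x y w = polarForm a y x w := by
  rw [polarForm, polarForm, annihilatorForm_comm a w x y]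
  ring

theorem polarForm_swap_right : polarForm a x y w = polarForm a x w y := by
  rw [polarForm, polarForm, annihilatorForm_comm a x y w]
  ring

theorem polarForm_add_right :
    polarForm a x y (w + w') = polarForm a x y w + polarForm a x y w' := by
  simp only [polarForm, annihilatorForm_add_left, annihilatorForm_add_right]
  ring

theorem polarForm_sub_right :
    polarForm a x y (w - w') = polarForm a x y w - polarForm a x y w' := by
  rw [eq_sub_iff_add_eq, ← polarForm_add_right, sub_add_cancel]

theorem polarForm_sub_middle :
    polarForm a x (y - y') w = polarForm a x y w - polarForm a x y' w := by
  rw [polarForm_swap_right, polarForm_sub_right, polarForm_swap_right a x w y,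
    polarForm_swap_right a x w y']

theorem polarForm_sub_left :
    polarForm a (x - x') y w = polarForm a x y w - polarForm a x' y w := by
  rw [polarForm_swap_left, polarForm_sub_middle, polarForm_swap_left a y x w,
    polarForm_swap_left a y x' w]

variable {a}

theorem polarForm_single (p q r : Vec) :
    polarForm a (Pi.single p 1) (Pi.single q 1) (Pi.single r 1) =
      (4 * (if q = r then a q p else 0) - a (q + r) p) +
      (4 * (if p = r then a p q else 0) - a (p + r) q) +
      (4 * (if p = q then a p r else 0) - a (p + q) r) := by
  have key (p q r : Vec) :
      annihilatorForm a (Pi.single p 1) (Pi.single q 1) (Pi.single r 1) =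
        4 * (if q = r then a q p else 0) - a (q + r) p := by
    have h1 (s : Vec) : ∑ t, (Pi.single q 1 : Vec → k) t * (Pi.single r 1 : Vec → k) (s + t) =
        if s = q + r then 1 else 0 := by
      rw [Finset.sum_eq_single q (fun t _ ht => by simp [ht]) (by simp)]
      have : s + q = r ↔ s = q + r := by
        rw [← Vec.add_eq_zero_iff, ← Vec.add_eq_zero_iff (x := s), add_assoc]
      simp [Pi.single_apply, this]
    have h2 (s : Vec) : ∑ t, a s t * (Pi.single p 1 : Vec → k) t = a s p := by
      simp [Pi.single_apply]
    simp only [annihilatorForm, h1, h2, mul_sub, Finset.sum_sub_distrib]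
    congr 1
    · rw [Finset.sum_eq_single q (fun t _ ht => by simp [ht]) (by simp)]
      by_cases hqr : q = r <;> simp [hqr, mul_comm]
    · simp
  rw [polarForm, key, key, key]

variable [CharZero k]

theorem polarForm_eq_zero {U : Submodule k (Vec → k)}
    (h : ∀ u ∈ U, annihilatorForm a u u u = 0) {x y w : Vec → k} (hx : x ∈ U) (hy : y ∈ U)
    (hw : w ∈ U) : polarForm a x y w = 0 := by
  have h1 := h _ (U.add_mem (U.add_mem hx hy) hw)
  have h2 := h _ (U.add_mem hx hy)
  have h3 := h _ (U.add_mem hx hw)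
  have h4 := h _ (U.add_mem hy hw)
  have h5 := h _ hx
  have h6 := h _ hy
  have h7 := h _ hw
  simp only [annihilatorForm_add_left, annihilatorForm_add_middle, annihilatorForm_add_right]
    at h1 h2 h3 h4
  have e1 := annihilatorForm_comm a x y w
  have e2 := annihilatorForm_comm a y x w
  have e3 := annihilatorForm_comm a w x y
  rw [polarForm]
  linear_combination (h1 - h2 - h3 - h4 + h5 + h6 + h7 + e1 + e2 + e3) / 2

/-- A matrix `a`, indexed by the nonzero vectors, with zero diagonal and constant column sums, whose
cubic form vanishes on the hyperplane of vectors with coordinate sum zero, is zero. The entries at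
the index `0` are set to zero. -/
theorem eq_zero_of_annihilatorForm_eq_zero {c : k} (hl : ∀ q, a 0 q = 0) (hr : ∀ p, a p 0 = 0)
    (hd : ∀ p, a p p = 0) (hc : ∀ q, q ≠ 0 → ∑ p, a p q = c)
    (h : ∀ u : Vec → k, u 0 = 0 → ∑ p, u p = 0 → annihilatorForm a u u u = 0) (p q : Vec) :
    a p q = 0 := by
  let U : Submodule k (Vec → k) :=
    { carrier := {u | u 0 = 0 ∧ ∑ p, u p = 0}
      zero_mem' := by simp
      add_mem' := fun hu hv => by
        simp only [Set.mem_ofPred_eq, Pi.add_apply, Finset.sum_add_distrib] at *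
        simp [hu, hv]
      smul_mem' := fun t u hu => by
        simp only [Set.mem_ofPred_eq, Pi.smul_apply, ← Finset.smul_sum] at *
        simp [hu] }
  have hU (p o : Vec) (hp : p ≠ 0) (ho : o ≠ 0) :
      (Pi.single p 1 - Pi.single o 1 : Vec → k) ∈ U := by
    constructor
    · simp [hp.symm, ho.symm]
    · simp [Finset.sum_sub_distrib]
  let F (p q r : Vec) : k := polarForm a (Pi.single p 1) (Pi.single q 1) (Pi.single r 1)
  have hFl (p q r : Vec) : F p q r = F q p r := polarForm_swap_left _ _ _ _
  have hFr (p q r : Vec) : F p q r = F p r q := polarForm_swap_right _ _ _ _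
  -- A cubic form which vanishes on the hyperplane is the product of the coordinate sum with a
  -- quadratic form, whose coefficients `g` are found by subtracting the base point `1` throughout.
  have hg : ∃ g : Vec → Vec → k, (∀ p q, g p q = g q p) ∧
      ∀ p q r, p ≠ 0 → q ≠ 0 → r ≠ 0 → F p q r = g p q + g p r + g q r := by
    have h1 : (1 : Vec) ≠ 0 := by decide
    refine ⟨fun p q => F p q 1 - (F p 1 1 + F q 1 1) / 2 + F 1 1 1 / 3, fun p q => ?_,
      fun p q r hp hq hr => ?_⟩
    · linear_combination hFl p q 1
    · have := polarForm_eq_zero (U := U) (fun u hu => h u hu.1 hu.2) (hU p 1 hp h1) (hU q 1 hq h1)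
        (hU r 1 hr h1)
      simp only [polarForm_sub_left, polarForm_sub_middle, polarForm_sub_right] at this
      change F p q r - F 1 q r - (F p 1 r - F 1 1 r) - (F p q 1 - F 1 q 1 - (F p 1 1 - F 1 1 1)) = 0
        at this
      rw [hFr p 1 r, hFl 1 q r, hFr q 1 r, hFl 1 q 1, hFr 1 1 r, hFl 1 r 1] at this
      linear_combination this
  obtain ⟨g, hgs, hg⟩ := hg
  simp only [F, polarForm_single] at hg
  have hgp (p : Vec) (hp : p ≠ 0) : g p p = 0 := by
    have := hg p p p hp hp hp
    simp only [if_true, Vec.add_self, hl, hd] at this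
    linear_combination -this / 3
  have hgpq (p q : Vec) (hp : p ≠ 0) (hq : q ≠ 0) : g p q = 2 * a p q - a (p + q) p := by
    by_cases hpq : p = q
    · subst hpq
      rw [hgp p hp, hd, Vec.add_self, hl]
      ring
    · have := hg p p q hp hp hq
      simp only [hpq, if_true, if_false, Vec.add_self, hl, hgp p hp] at this
      linear_combination -this / 2
  let R (p : Vec) : k := ∑ q, a p q
  have hR0 : R 0 = 0 := Finset.sum_eq_zero fun q _ => hl q
  have hcol (p q : Vec) (hq : q ≠ 0) : ∑ r, a (p + r) q = c := by
    rw [Vec.sum_add_left p fun r => a r q, hc q hq]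
  have hS (p : Vec) (hp : p ≠ 0) : ∑ r, (2 * a p r - a (p + r) p) = 2 * R p - c := by
    rw [Finset.sum_sub_distrib, ← Finset.mul_sum, hcol p p hp]
  -- the sum of the coefficient equations over the third index
  have hpair (p q : Vec) (hp : p ≠ 0) (hq : q ≠ 0) (hpq : p ≠ q) :
      5 * (a p q + a q p) = 15 * (2 * a p q - a (p + q) p) + 2 * R p + 2 * R q + R (p + q) := by
    have hterm (r : Vec) : (4 * (if q = r then a q p else 0) - a (q + r) p) +
        (4 * (if p = r then a p q else 0) - a (p + r) q) - a (p + q) r =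
        (2 * a p q - a (p + q) p) + (2 * a p r - a (p + r) p) + (2 * a q r - a (q + r) q) -
          if r = 0 then a p q + a q p + (2 * a p q - a (p + q) p) else 0 := by
      by_cases h0 : r = 0
      · subst h0
        simp only [hp, hq, if_true, if_false, add_zero, hr, hd]
        ring
      · have := hg p q r hp hq h0
        rw [hgpq p q hp hq, hgpq p r hp h0, hgpq q r hq h0] at this
        simp only [hpq, if_false] at this
        simp only [h0, if_false]
        linear_combination this
    have hsum := Finset.sum_congr (rfl : (Finset.univ : Finset Vec) = _) fun r _ => hterm r
    simp only [Finset.sum_add_distrib, Finset.sum_sub_distrib, ← Finset.mul_sum, hcol q p hp,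
      hcol p q hq, hcol p p hp, hcol q q hq, Finset.sum_ite_eq, Finset.sum_ite_eq', Finset.mem_univ,
      if_true, Finset.sum_const, Finset.card_univ, Vec.card_eq, nsmul_eq_mul] at hsum
    push_cast at hsum
    simp only [R]
    linear_combination hsum
  have hRsum : ∑ p, R p = 15 * c := by
    simp only [R]
    rw [Finset.sum_comm]
    have : ∀ q, ∑ p, a p q = c - if q = 0 then c else 0 := by
      intro q
      by_cases h0 : q = 0
      · simp [h0, hr]
      · simp [h0, hc q h0]
    simp only [this, Finset.sum_sub_distrib, Finset.sum_ite_eq', Finset.mem_univ, if_true,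
      Finset.sum_const, Finset.card_univ, Vec.card_eq, nsmul_eq_mul]
    push_cast
    ring
  -- the sum of these equations over the second index
  have hRc (p : Vec) (hp : p ≠ 0) : 2 * R p = -c := by
    have hq (q : Vec) : 5 * (a p q + a q p) =
        15 * (2 * a p q - a (p + q) p) + 2 * R p + 2 * R q + R (p + q) -
          ((if q = 0 then 3 * R p else 0) + if q = p then 4 * R p else 0) := by
      by_cases h0 : q = 0
      · subst h0
        simp only [hp.symm, if_true, if_false, add_zero, hr, hl, hd, hR0]
        ring
      by_cases h1 : q = p
      · subst h1
        simp only [h0, if_true, if_false, Vec.add_self, hl, hd, hR0]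
        ring
      · simp only [h0, h1, if_false, hpair p q hp h0 (Ne.symm h1)]
        ring
    have hsum := Finset.sum_congr (rfl : (Finset.univ : Finset Vec) = _) fun q _ => hq q
    simp only [Finset.sum_add_distrib, Finset.sum_sub_distrib, ← Finset.mul_sum, hcol p p hp,
      hc p hp, Finset.sum_ite_eq', Finset.mem_univ, Vec.sum_add_left p R, hRsum,
      if_true, Finset.sum_const, Finset.card_univ, Vec.card_eq, nsmul_eq_mul] at hsum
    push_cast at hsum
    simp only [R] at hsum ⊢
    linear_combination -hsum / 25
  have hc0 : c = 0 := by
    have : ∀ p, 2 * R p = -c + if p = 0 then c else 0 := by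
      intro p
      by_cases h0 : p = 0
      · simp [h0, hR0]
      · simp [h0, hRc p h0]
    have hsum := Finset.sum_congr (rfl : (Finset.univ : Finset Vec) = _) fun q _ => this q
    simp only [Finset.sum_add_distrib, ← Finset.mul_sum, hRsum, Finset.sum_ite_eq',
      Finset.mem_univ, if_true, Finset.sum_const, Finset.card_univ, Vec.card_eq, nsmul_eq_mul]
      at hsum
    push_cast at hsum
    linear_combination hsum / 45
  have hR (p : Vec) : R p = 0 := by
    by_cases h0 : p = 0
    · rw [h0, hR0]
    · linear_combination (hRc p h0 - hc0) / 2
  have hfin (p q : Vec) (hp : p ≠ 0) (hq : q ≠ 0) (hpq : p ≠ q) :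
      a q p = 5 * a p q - 3 * a (p + q) p := by
    have := hpair p q hp hq hpq
    rw [hR, hR, hR] at this
    linear_combination this / 5
  by_cases hp : p = 0
  · rw [hp, hl]
  by_cases hq : q = 0
  · rw [hq, hr]
  by_cases hpq : p = q
  · rw [hpq, hd]
  have hs : p + q ≠ 0 := fun h0 => hpq (Vec.add_eq_zero_iff.mp h0)
  have hsp : p ≠ p + q := fun h0 => hq (by simpa using h0.symm)
  have hsq : q ≠ p + q := fun h0 => hp (by simpa using h0.symm)
  have e3 : p + (p + q) = q := Vec.add_add_cancel p q
  have e4 : q + (p + q) = p := by rw [add_comm p q, Vec.add_add_cancel]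
  have f1 := hfin p q hp hq hpq
  have f2 := hfin q p hq hp (Ne.symm hpq)
  have f3 := hfin p (p + q) hp hs hsp
  have f4 := hfin (p + q) p hs hp hsp.symm
  have f5 := hfin q (p + q) hq hs hsq
  have f6 := hfin (p + q) q hs hq hsq.symm
  rw [add_comm q p] at f2
  rw [e3] at f3
  rw [add_comm (p + q) p, e3] at f4
  rw [e4] at f5
  rw [add_comm (p + q) q, e4] at f6
  -- The equations `f1`, …, `f6` involve only the six entries of `a` on the line `{p, q, p + q}`.
  -- The coefficients are a row of the inverse of this `6 × 6` system.
  linear_combination (-5/16) * f1 + (-1/8) * f2 + (-5/48) * f3 + (-5/24) * f4 + (-7/48) * f5 +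
    (-5/48) * f6

end Annihilator

/-! ### The skew-invariant cubic -/

section Cubic

variable {k : Type*} [Field k]

/-- The sum of the cubes of the Fourier transforms is, up to `16`, the sum of the products over all
triples with sum zero. -/
theorem sum_fourier_cube {A : Type*} [CommRing A] (b : Vec → Vec)
    (hb : ∀ q, ∑ p, chi (b p) q = if q = 0 then 16 else 0) (Z : Vec → A) :
    ∑ p, (∑ q, (chi (b p) q : A) * Z q) ^ 3 = 16 * ∑ q, ∑ r, Z q * Z r * Z (q + r) := by
  have hcube (p : Vec) : (∑ q, (chi (b p) q : A) * Z q) ^ 3 =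
      ∑ q, ∑ r, ∑ s, Z q * Z r * Z s * (chi (b p) (q + r + s) : A) := by
    rw [pow_succ, pow_two, Finset.sum_mul_sum]
    simp only [Finset.sum_mul, Finset.mul_sum, chi_add, Int.cast_mul]
    refine Finset.sum_congr rfl fun q _ => Finset.sum_congr rfl fun r _ =>
      Finset.sum_congr rfl fun s _ => ?_
    ring
  simp only [hcube]
  rw [Finset.sum_comm, Finset.mul_sum]
  refine Finset.sum_congr rfl fun q _ => ?_
  rw [Finset.sum_comm, Finset.mul_sum]
  refine Finset.sum_congr rfl fun r _ => ?_
  rw [Finset.sum_comm]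
  simp only [← Finset.mul_sum, ← Int.cast_sum, hb, Vec.add_eq_zero_iff]
  simp
  ring

/-- The image of `z_p` in the symmetric algebra. -/
noncomputable def symForm (k : Type*) [Field k] (p : Vec) : SymmetricAlgebra k (R₁ k) :=
  SymmetricAlgebra.ι k (R₁ k) (steinerForm k p)

/-- The sum of the cubes of the `z_p`. -/
noncomputable def cubeSum (k : Type*) [Field k] : SymmetricAlgebra k (R₁ k) :=
  ∑ p, symForm k p ^ 3

/-- The sum of the products `z_p z_q z_r` over all `p + q + r = 0`, which is six times the sum over
the lines of the projective space. -/
noncomputable def lineSum (k : Type*) [Field k] : SymmetricAlgebra k (R₁ k) :=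
  ∑ p, ∑ q, symForm k p * symForm k q * symForm k (p + q)

/-- The skew-invariant cubic, with the weights for which a transposition exchanges its two terms. -/
noncomputable def skewCubic (k : Type*) [Field k] : SymmetricAlgebra k (R₁ k) :=
  4 * cubeSum k - lineSum k

theorem symMap_symForm (f : R₁ k →ₗ[k] R₁ k) (p : Vec) :
    symMap f (symForm k p) = SymmetricAlgebra.ι k (R₁ k) (f (steinerForm k p)) := by
  simp [symMap, symForm]

theorem symMap_comp {V : Type*} [AddCommGroup V] [Module k V] (f g : V →ₗ[k] V)
    (s : SymmetricAlgebra k V) : symMap (f ∘ₗ g) s = symMap f (symMap g s) := by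
  have h : symMap (f ∘ₗ g) = (symMap f).comp (symMap g) := by
    ext v
    simp [symMap]
  exact congr($h s)

theorem symMap_id {V : Type*} [AddCommGroup V] [Module k V] (s : SymmetricAlgebra k V) :
    symMap LinearMap.id s = s := by
  have h : symMap (LinearMap.id : V →ₗ[k] V) = AlgHom.id k _ := by
    ext v
    simp [symMap]
  exact congr($h s)

theorem symMap_permRep_mul (σ τ : Equiv.Perm (Fin 8)) (s : SymmetricAlgebra k (R₁ k)) :
    symMap (permRep k 8 1 (σ * τ)) s = symMap (permRep k 8 1 σ) (symMap (permRep k 8 1 τ) s) := by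
  rw [map_mul, ← symMap_comp]
  rfl

theorem symMap_permRep_one (s : SymmetricAlgebra k (R₁ k)) :
    symMap (permRep k 8 1 1) s = s := by
  rw [map_one]
  exact symMap_id s

theorem symForm_zero : symForm k 0 = 0 := by
  rw [symForm, steinerForm_zero, map_zero]

theorem symForm_mul_mem (p q r : Vec) :
    symForm k p * symForm k q * symForm k r ∈ symPower k (R₁ k) 3 := by
  rw [symPower, pow_succ, pow_two]
  exact Submodule.mul_mem_mul (Submodule.mul_mem_mul ⟨_, rfl⟩ ⟨_, rfl⟩) ⟨_, rfl⟩

theorem skewCubic_mem_symPower : skewCubic k ∈ symPower k (R₁ k) 3 := by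
  have h4 : (4 : SymmetricAlgebra k (R₁ k)) * cubeSum k = (4 : k) • cubeSum k := by
    rw [Algebra.smul_def, map_ofNat]
  rw [skewCubic, h4]
  refine Submodule.sub_mem _ (Submodule.smul_mem _ _ (Submodule.sum_mem _ fun p _ => ?_))
    (Submodule.sum_mem _ fun p _ => Submodule.sum_mem _ fun q _ => symForm_mul_mem _ _ _)
  rw [pow_succ, pow_two]
  exact symForm_mul_mem _ _ _

variable [CharZero k]

theorem sum_symForm : ∑ p, symForm k p = 0 := by
  simp only [symForm]
  rw [← map_sum, sum_steinerForm, map_zero]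

/-- A transposition of neighbouring points exchanges the two constituents of the skew cubic. -/
theorem symMap_swap_cubeSum (a : Fin 7) :
    4 * symMap (permRep k 8 1 (Equiv.swap a.castSucc a.succ)) (cubeSum k) = lineSum k := by
  have h := sum_fourier_cube _ (sum_chi_polar a) (symForm k)
  have hp (p : Vec) : symMap (permRep k 8 1 (Equiv.swap a.castSucc a.succ)) (symForm k p) =
      (4⁻¹ : k) • ∑ q, (chi (polar a.castSucc a.succ p) q : SymmetricAlgebra k (R₁ k)) *
        symForm k q := by
    rw [symMap_symForm, permRep_swap_steinerForm, map_smul, map_sum]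
    congr 1
    refine Finset.sum_congr rfl fun q _ => ?_
    rw [map_smul, Algebra.smul_def, map_intCast]
    rfl
  rw [cubeSum, map_sum]
  simp only [map_pow, hp, smul_pow]
  rw [← Finset.smul_sum, h, lineSum]
  have h4 : (4 : SymmetricAlgebra k (R₁ k)) = algebraMap k _ 4 := by rw [map_ofNat]
  have h16 : (16 : SymmetricAlgebra k (R₁ k)) = algebraMap k _ 16 := by rw [map_ofNat]
  rw [h4, h16, ← Algebra.smul_def, ← Algebra.smul_def, smul_smul, smul_smul]
  norm_num

theorem symMap_swap_lineSum (a : Fin 7) :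
    symMap (permRep k 8 1 (Equiv.swap a.castSucc a.succ)) (lineSum k) = 4 * cubeSum k := by
  rw [← symMap_swap_cubeSum a, map_mul, map_ofNat, ← symMap_permRep_mul, Equiv.swap_mul_self,
    symMap_permRep_one]

theorem symMap_skewCubic (σ : Equiv.Perm (Fin 8)) :
    symMap (permRep k 8 1 σ) (skewCubic k) = (Equiv.Perm.sign σ : ℤ) • skewCubic k := by
  have hσ : σ ∈ Submonoid.closure
      (Set.range fun i : Fin 7 => Equiv.swap i.castSucc i.succ) := by
    rw [Equiv.Perm.mclosure_swap_castSucc_succ]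
    trivial
  induction hσ using Submonoid.closure_induction with
  | mem σ h =>
    obtain ⟨a, rfl⟩ := h
    simp only
    rw [skewCubic, map_sub, map_mul, map_ofNat, symMap_swap_cubeSum, symMap_swap_lineSum,
      Equiv.Perm.sign_swap a.castSucc_lt_succ.ne]
    simp
  | one =>
    rw [symMap_permRep_one]
    simp
  | mul σ τ _ _ h1 h2 =>
    rw [symMap_permRep_mul, h2, map_zsmul, h1, smul_smul, map_mul, Units.val_mul, mul_comm]

theorem skewCubic_mem : skewCubic k ∈ skewCubics k :=
  ⟨skewCubic_mem_symPower, symMap_skewCubic⟩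

end Cubic

/-! ### The annihilator of the skew cubic -/

section Annihilator

variable {k : Type*} [Field k]

/-- The three factors of `z_p z_q z_{p + q}` play the same role, so that each of them contributes
the same sum to the derivative. -/
theorem derivation_cubic {A : Type*} [CommRing A] [Algebra k A] (D : Derivation k A A)
    (Z : Vec → A) :
    D (4 * ∑ p, Z p ^ 3 - ∑ p, ∑ q, Z p * Z q * Z (p + q)) =
      3 * ∑ p, D (Z p) * (4 * (Z p * Z p) - ∑ r, Z r * Z (p + r)) := by
  have h4 : D 4 = 0 := by simpa using D.map_natCast 4
  have hcube (p : Vec) : D (Z p ^ 3) = 3 * (D (Z p) * (Z p * Z p)) := by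
    rw [D.leibniz_pow]
    simp only [nsmul_eq_mul, smul_eq_mul]
    push_cast
    ring
  have hline (p q : Vec) : D (Z p * Z q * Z (p + q)) = D (Z p) * (Z q * Z (p + q)) +
      D (Z q) * (Z p * Z (q + p)) + D (Z (p + q)) * (Z p * Z q) := by
    rw [D.leibniz, D.leibniz, add_comm q p]
    simp only [smul_eq_mul]
    ring
  have hthird : ∑ p, ∑ q, D (Z (p + q)) * (Z p * Z q) =
      ∑ p, ∑ q, D (Z p) * (Z q * Z (p + q)) := by
    rw [Finset.sum_comm (f := fun p q => D (Z p) * (Z q * Z (p + q)))]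
    refine Finset.sum_congr rfl fun p _ => ?_
    rw [← Vec.sum_add_left p]
    simp only [Vec.add_add_cancel, add_comm _ p]
  rw [map_sub, D.leibniz, h4]
  simp only [map_sum, hcube, hline, Finset.sum_add_distrib, hthird]
  rw [Finset.sum_comm (f := fun p q => D (Z q) * (Z p * Z (q + p)))]
  simp only [mul_sub, Finset.sum_sub_distrib, Finset.mul_sum, smul_eq_mul, mul_zero, add_zero,
    ← Finset.sum_add_distrib]
  congr 1
  · refine Finset.sum_congr rfl fun p _ => ?_
    ring
  · refine Finset.sum_congr rfl fun p _ => Finset.sum_congr rfl fun q _ => ?_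
    ring

variable [CharZero k]

/-- By the relation `∑ q, z_q = 0`, the coefficient of a given `z_p` can be made zero. -/
theorem exists_eq_sum_steinerForm_of_ne (f : R₁ k) (p : Vec) :
    ∃ c : Vec → k, c 0 = 0 ∧ c p = 0 ∧ f = ∑ q, c q • steinerForm k q := by
  obtain ⟨c, hc⟩ := exists_eq_sum_steinerForm f
  refine ⟨fun q => if q = 0 then 0 else c q - c p, by simp, by simp, ?_⟩
  have h (q : Vec) : (if q = 0 then 0 else c q - c p) • steinerForm k q =
      c q • steinerForm k q - c p • steinerForm k q := by
    by_cases hq : q = 0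
    · simp [hq, steinerForm_zero]
    · rw [if_neg hq]
      exact sub_smul (c q) (c p) (steinerForm k q)
  simp only [h, Finset.sum_sub_distrib, ← Finset.smul_sum, sum_steinerForm, smul_zero, sub_zero]
  exact hc

/-- The annihilator of the skew cubic in `𝔤𝔩(R₁)` is zero. -/
theorem eq_zero_of_lieAction_skewCubic {A : Module.End k (R₁ k)}
    (hA : lieAction A (skewCubic k) = 0) : A = 0 := by
  have hex (p : Vec) : ∃ c : Vec → k, c 0 = 0 ∧ c p = 0 ∧ (p = 0 → c = 0) ∧
      A (steinerForm k p) = ∑ q, c q • steinerForm k q := by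
    by_cases hp : p = 0
    · exact ⟨0, by simp [hp, steinerForm_zero]⟩
    · obtain ⟨c, h0, h1, h2⟩ := exists_eq_sum_steinerForm_of_ne (A (steinerForm k p)) p
      exact ⟨c, h0, h1, fun h => absurd h hp, h2⟩
  choose a ha0 had haz ha using hex
  have hcol : ∑ q, (∑ p, a p q) • steinerForm k q = 0 := by
    simp only [Finset.sum_smul]
    rw [Finset.sum_comm]
    simp only [← ha]
    rw [← map_sum, sum_steinerForm, map_zero]
  -- Column sums are constant because `A` respects the relation `∑ p, z_p = 0`. The cubic form of
  -- `a` vanishes on the hyperplane because its points are the values of linear forms at the `z_p`.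
  have hzero := eq_zero_of_annihilatorForm_eq_zero (a := a)
    (fun q => by rw [haz 0 rfl]; rfl) ha0 had
    (c := (∑ q, ∑ p, a p q) / 15) (fun q hq => by
      rw [eq_div_iff (by norm_num), mul_comm]
      exact sum_smul_steinerForm_eq_zero (a := fun q => ∑ p, a p q)
        (Finset.sum_eq_zero fun p _ => ha0 p) hcol hq)
    (fun u hu0 hu => by
      obtain ⟨l, hl⟩ := exists_dual_steinerForm hu0 hu
      have hev (p : Vec) : SymmetricAlgebra.lift l (symForm k p) = u p := by
        rw [symForm, SymmetricAlgebra.lift_ι_apply, hl]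
      have hD (p : Vec) : SymmetricAlgebra.lift l (lieAction A (symForm k p)) =
          ∑ q, a p q * u q := by
        rw [lieAction, symForm, symDerivation_ι, LinearMap.comp_apply,
          SymmetricAlgebra.lift_ι_apply, ha, map_sum]
        simp only [map_smul, hl, smul_eq_mul]
      have h := congrArg (SymmetricAlgebra.lift l) hA
      rw [skewCubic, cubeSum, lineSum, derivation_cubic] at h
      simp only [map_mul, map_sum, map_sub, hD, hev, map_ofNat, map_zero] at h
      exact (mul_eq_zero.mp h).resolve_left (by norm_num))
  refine (steinerBasis k).ext fun i => ?_
  rw [steinerBasis, Module.Basis.mk_apply, ha]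
  simp [hzero]

/-- The identity of `R₁` annihilates the zero cubic, but not the skew cubic. -/
theorem skewCubic_ne_zero : skewCubic k ≠ 0 := by
  intro h
  have h1 : (1 : Module.End k (R₁ k)) = 0 :=
    eq_zero_of_lieAction_skewCubic (by rw [h, map_zero])
  have : Subsingleton (R₁ k) :=
    ⟨fun x y => by
      rw [← Module.End.one_apply (R := k) x, ← Module.End.one_apply (R := k) y, h1]
      rfl⟩
  have h14 := finrank_R₁ (k := k)
  rw [Module.finrank_zero_of_subsingleton] at h14
  exact absurd h14 (by norm_num)

end Annihilator

/-! ### Uniqueness of the skew-invariant cubic -/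

theorem exists_dot_eq : ∀ p q r : Vec, r ≠ 0 → r ≠ p → r ≠ q → r ≠ p + q →
    ∃ φ, dot φ p = false ∧ dot φ q = false ∧ dot φ r = true := by
  decide +kernel

theorem exists_dot_dot_eq : ∀ φ ψ : Vec, φ ≠ 0 → ψ ≠ 0 → ∃ r, dot φ r = true ∧ dot ψ r = true := by
  decide +kernel

/-- A function which is invariant under the transvections fixing `p` and `q` is constant outside the
span of `p` and `q`. -/
theorem eq_of_forall_transvection {M : Type*} {p q : Vec} {g : Vec → M}
    (hg : ∀ v φ, v ≠ 0 → φ ≠ 0 → dot φ v = false → dot φ p = false → dot φ q = false →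
      ∀ r, g (transvection v φ r) = g r)
    {r s : Vec} (hr : r ≠ 0 ∧ r ≠ p ∧ r ≠ q ∧ r ≠ p + q)
    (hs : s ≠ 0 ∧ s ≠ p ∧ s ≠ q ∧ s ≠ p + q) : g r = g s := by
  have key (φ r s : Vec) (hp : dot φ p = false) (hq : dot φ q = false) (hr : dot φ r = true)
      (hs : dot φ s = true) : g r = g s := by
    by_cases hrs : r = s
    · rw [hrs]
    · have hφ : φ ≠ 0 := by
        rintro rfl
        rw [dot_comm, dot_zero] at hr
        cases hr
      have h := hg (r + s) φ (fun h0 => hrs (Vec.add_eq_zero_iff.mp h0)) hφ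
        (by rw [dot_add, hr, hs]; rfl) hp hq r
      rw [transvection_apply, hr, if_pos rfl, Vec.add_add_cancel] at h
      exact h.symm
  have hne {φ r : Vec} (h : dot φ r = true) : φ ≠ 0 := by
    rintro rfl
    rw [dot_comm, dot_zero] at h
    cases h
  obtain ⟨φ, hφp, hφq, hφr⟩ := exists_dot_eq p q r hr.1 hr.2.1 hr.2.2.1 hr.2.2.2
  obtain ⟨ψ, hψp, hψq, hψs⟩ := exists_dot_eq p q s hs.1 hs.2.1 hs.2.2.1 hs.2.2.2
  obtain ⟨t, hφt, hψt⟩ := exists_dot_dot_eq φ ψ (hne hφr) (hne hψs)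
  exact (key φ r t hφp hφq hφr hφt).trans (key ψ t s hψp hψq hψt hψs)

theorem transvection_eq_self {v φ p : Vec} (h : dot φ p = false) : transvection v φ p = p := by
  rw [transvection_apply, h]
  simp

section Uniqueness

variable {k : Type*} [Field k] [CharZero k] {M : Type*} [AddCommGroup M] [Module k M]

/-- A symmetric function of three vectors which satisfies the relations of the products
`z_p z_q z_r`, is invariant under transvections, and changes sign under the Fourier transform, is
determined by one value. -/
theorem exists_smul_eq_of_transvection {Φ : Vec → Vec → Vec → M}
    (h0 : ∀ q r, Φ 0 q r = 0) (hl : ∀ p q r, Φ p q r = Φ q p r) (hr : ∀ p q r, Φ p q r = Φ p r q)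
    (hsum : ∀ p q, ∑ r, Φ p q r = 0)
    (hinv : ∀ v φ, v ≠ 0 → φ ≠ 0 → dot φ v = false → ∀ p q r,
      Φ (transvection v φ p) (transvection v φ q) (transvection v φ r) = Φ p q r)
    (hfour : ∑ p, ∑ q, Φ p q (p + q) = -(4 : k) • ∑ p, Φ p p p) (p q r : Vec) :
    ∃ c : k, Φ p q r = c • Φ 1 1 1 := by
  set m := Φ 1 1 1 with hm
  have h1 : (1 : Vec) ≠ 0 := by decide
  have h0' (p r : Vec) : Φ p 0 r = 0 := by rw [hl, h0]
  have h0'' (p q : Vec) : Φ p q 0 = 0 := by rw [hr, h0']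
  have hppp (p : Vec) (hp : p ≠ 0) : Φ p p p = m :=
    eq_of_forall_transvection (p := 0) (q := 0) (g := fun r => Φ r r r)
      (fun v φ hv hφ hφv _ _ r => hinv v φ hv hφ hφv r r r) (by simpa using hp) (by simp [h1])
  have hsmul {n : k} (hn : n ≠ 0) {x y : M} (h : n • x = y) : x = n⁻¹ • y := by
    rw [← h, inv_smul_smul₀ hn]
  -- `Φ p p r` has the same value for the `14` vectors `r ≠ 0, p`, and its sum over `r` is zero.
  have hppq (p q : Vec) (hp : p ≠ 0) (hq : q ≠ 0) (hpq : q ≠ p) : Φ p p q = -(14 : k)⁻¹ • m := by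
    have hconst (r : Vec) : Φ p p r = Φ p p q + (if r = p then m - Φ p p q else 0) -
        if r = 0 then Φ p p q else 0 := by
      by_cases hr0 : r = 0
      · subst hr0
        simp [h0'', hp.symm]
      by_cases hrp : r = p
      · subst hrp
        simp [hppp r hp, hp]
      · simp only [hr0, hrp, if_false, add_zero, sub_zero]
        exact eq_of_forall_transvection (p := p) (q := p) (g := fun r => Φ p p r)
          (fun v φ hv hφ hφv hφp _ r => by
            simpa only [transvection_eq_self hφp] using hinv v φ hv hφ hφv p p r)
          (by simp [hr0, hrp, Vec.add_self]) (by simp [hq, hpq, Vec.add_self])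
    have h := hsum p p
    rw [Finset.sum_congr rfl fun r _ => hconst r] at h
    simp only [Finset.sum_sub_distrib, Finset.sum_add_distrib, Finset.sum_const, Finset.card_univ,
      Vec.card_eq, Finset.sum_ite_eq', Finset.mem_univ, if_true] at h
    rw [neg_smul, ← smul_neg]
    refine hsmul (by norm_num) ?_
    rw [eq_neg_iff_add_eq_zero, ← h, ← Nat.cast_smul_eq_nsmul k]
    push_cast
    module
  have hline_aux (p q r : Vec) (hp : p ≠ 0) (hq : q ≠ 0) (hpq : q ≠ p) (hr0 : r ≠ 0)
      (hpr : r ≠ p) : Φ p q (p + q) = Φ p r (p + r) :=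
    eq_of_forall_transvection (p := p) (q := p) (g := fun r => Φ p r (p + r))
      (fun v φ hv hφ hφv hφp _ r => by
        simpa only [map_add, transvection_eq_self hφp] using hinv v φ hv hφ hφv p r (p + r))
      (by simp [hq, hpq, Vec.add_self]) (by simp [hr0, hpr, Vec.add_self])
  have hline_eq (p q p' q' : Vec) (hp : p ≠ 0) (hq : q ≠ 0) (hpq : q ≠ p) (hp' : p' ≠ 0)
      (hq' : q' ≠ 0) (hpq' : q' ≠ p') : Φ p q (p + q) = Φ p' q' (p' + q') := by
    by_cases hpp : p' = p
    · subst hpp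
      exact hline_aux _ _ _ hp hq hpq hq' hpq'
    · rw [hline_aux p q p' hp hq hpq hp' hpp, hl, add_comm p p',
        hline_aux p' p q' hp' hp (Ne.symm hpp) hq' hpq']
  -- There are `15 * 14` ordered pairs of distinct nonzero vectors, so that the Fourier relation
  -- reads `210 Φ p q (p + q) = -4 * 15 m`.
  have hline (p q : Vec) (hp : p ≠ 0) (hq : q ≠ 0) (hpq : q ≠ p) :
      Φ p q (p + q) = -(2 / 7 : k) • m := by
    have hconst (p' q' : Vec) : Φ p' q' (p' + q') = Φ p q (p + q) -
        (if q' = p' then Φ p q (p + q) else 0) - (if q' = 0 then Φ p q (p + q) else 0) -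
        if p' = 0 then Φ p q (p + q) - (if q' = 0 then (2 : k) • Φ p q (p + q) else 0) else 0 := by
      by_cases hp0 : p' = 0
      · subst hp0
        by_cases hq0 : q' = 0
        · simp only [hq0, h0, if_true]
          module
        · simp [hq0, h0]
      by_cases hq0 : q' = 0
      · subst hq0
        simp [Ne.symm hp0, hp0, h0']
      by_cases hpq' : q' = p'
      · subst hpq'
        simp [hp0, Vec.add_self, h0'']
      · simp only [hp0, hq0, hpq', if_false, sub_zero]
        exact hline_eq _ _ _ _ hp0 hq0 hpq' hp hq hpq
    have hcube (p' : Vec) : Φ p' p' p' = m - if p' = 0 then m else 0 := by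
      by_cases hp0 : p' = 0
      · simp [hp0, h0]
      · simp [hp0, hppp p' hp0]
    have h := hfour
    rw [Finset.sum_congr rfl fun p' _ => Finset.sum_congr rfl fun q' _ => hconst p' q',
      Finset.sum_congr rfl fun p' _ => hcube p'] at h
    have hite (p' : Vec) (x : M) : ∑ q' : Vec, (if p' = 0 then
        x - (if q' = 0 then (2 : k) • x else 0) else 0) =
          if p' = 0 then (14 : k) • x else 0 := by
      by_cases hp0 : p' = 0
      · simp only [hp0, if_true, Finset.sum_sub_distrib, Finset.sum_const, Finset.card_univ,
          Vec.card_eq, Finset.sum_ite_eq', Finset.mem_univ]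
        rw [← Nat.cast_smul_eq_nsmul k]
        push_cast
        module
      · simp [hp0]
    simp only [Finset.sum_sub_distrib, Finset.sum_const, Finset.card_univ, hite,
      Vec.card_eq, Finset.sum_ite_eq', Finset.mem_univ, if_true] at h
    simp only [← Nat.cast_smul_eq_nsmul k] at h
    push_cast at h
    have h' : (210 : k) • Φ p q (p + q) = -(60 : k) • m := by
      rw [← sub_eq_zero] at h ⊢
      rw [← h]
      module
    rw [hsmul (by norm_num) h', smul_smul]
    norm_num
  -- `Φ p q t` has the same value for the `12` vectors `t` outside the span of `p` and `q`; the
  -- others are known, and the sum over `t` is zero.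
  have hgen (p q r : Vec) (hp : p ≠ 0) (hq : q ≠ 0) (hpq : q ≠ p) (hr0 : r ≠ 0) (hrp : r ≠ p)
      (hrq : r ≠ q) (hrs : r ≠ p + q) : Φ p q r = (1 / 28 : k) • m := by
    have hs0 : p + q ≠ 0 := fun h => hpq (Vec.add_eq_zero_iff.mp h).symm
    have hsp : p + q ≠ p := fun h => hq (by simpa using h)
    have hsq : p + q ≠ q := fun h => hp (by simpa using h)
    have e1 : Φ p q p = -(14 : k)⁻¹ • m := by rw [hr, hppq p q hp hq hpq]
    have e2 : Φ p q q = -(14 : k)⁻¹ • m := by rw [hl, hr, hppq q p hq hp hpq.symm]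
    have e3 := hline p q hp hq hpq
    have hconst (t : Vec) : Φ p q t = Φ p q r + (if t = p then -(14 : k)⁻¹ • m - Φ p q r else 0) +
        (if t = q then -(14 : k)⁻¹ • m - Φ p q r else 0) +
        (if t = p + q then -(2 / 7 : k) • m - Φ p q r else 0) - if t = 0 then Φ p q r else 0 := by
      by_cases t0 : t = 0
      · subst t0
        simp [h0'', hp.symm, hq.symm, hs0.symm]
      by_cases tp : t = p
      · subst tp
        simp [e1, t0, hpq.symm, hsp.symm]
      by_cases tq : t = q
      · subst tq
        simp [e2, t0, hpq, hsq.symm]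
      by_cases ts : t = p + q
      · subst ts
        simp only [e3, t0, tp, tq, if_false, if_true]
        abel
      · simp only [t0, tp, tq, ts, if_false, add_zero, sub_zero]
        exact eq_of_forall_transvection (p := p) (q := q) (g := fun r => Φ p q r)
          (fun v φ hv hφ hφv hφp hφq r => by
            simpa only [transvection_eq_self hφp, transvection_eq_self hφq] using
              hinv v φ hv hφ hφv p q r)
          ⟨t0, tp, tq, ts⟩ ⟨hr0, hrp, hrq, hrs⟩
    have h := hsum p q
    rw [Finset.sum_congr rfl fun r _ => hconst r] at h
    simp only [Finset.sum_sub_distrib, Finset.sum_add_distrib, Finset.sum_const, Finset.card_univ,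
      Vec.card_eq, Finset.sum_ite_eq', Finset.mem_univ, if_true] at h
    rw [← Nat.cast_smul_eq_nsmul k] at h
    push_cast at h
    have h' : (12 : k) • Φ p q r = (3 / 7 : k) • m := by
      rw [← sub_eq_zero] at h ⊢
      rw [← h]
      module
    rw [hsmul (by norm_num) h', smul_smul]
    norm_num
  by_cases hp : p = 0
  · exact ⟨0, by rw [hp, h0, zero_smul]⟩
  by_cases hq : q = 0
  · exact ⟨0, by rw [hq, h0', zero_smul]⟩
  by_cases hr0 : r = 0
  · exact ⟨0, by rw [hr0, h0'', zero_smul]⟩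
  by_cases hpq : q = p
  · subst hpq
    by_cases hrq : r = q
    · exact ⟨1, by rw [hrq, hppp q hq, one_smul]⟩
    · exact ⟨_, hppq q r hq hr0 hrq⟩
  by_cases hrp : r = p
  · exact ⟨_, by rw [hrp, hr, hppq p q hp hq hpq]⟩
  by_cases hrq : r = q
  · exact ⟨_, by rw [hrq, hl, hr, hppq q p hq hp (Ne.symm hpq)]⟩
  by_cases hrs : r = p + q
  · exact ⟨_, by rw [hrs, hline p q hp hq hpq]⟩
  · exact ⟨_, hgen p q r hp hq hpq hr0 hrp hrq hrs⟩

end Uniqueness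

/-! ### Antisymmetrization -/

section TwistedSum

variable {k G M : Type*} [Field k] [Group G] [Fintype G] [AddCommMonoid M] [Module k M]

/-- The operator `∑ g, χ g • ρ g` of a representation `ρ`, for a character `χ`. -/
def twistedSum (χ : G →* k) (ρ : Representation k G M) : M →ₗ[k] M := ∑ g, χ g • ρ g

theorem twistedSum_apply (χ : G →* k) (ρ : Representation k G M) (s : M) :
    twistedSum χ ρ s = ∑ g, χ g • ρ g s := by
  simp [twistedSum]

theorem twistedSum_rep {χ : G →* k} (hχ : ∀ g, χ g * χ g = 1) (ρ : Representation k G M) (h : G)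
    (s : M) : twistedSum χ ρ (ρ h s) = χ h • twistedSum χ ρ s := by
  rw [twistedSum_apply, twistedSum_apply, Finset.smul_sum]
  refine Fintype.sum_equiv (Equiv.mulRight h) _ _ fun g => ?_
  rw [smul_smul, Equiv.coe_mulRight, map_mul, map_mul, Module.End.mul_apply, mul_left_comm, hχ,
    mul_one]

/-- Up to a nonzero scalar there is a projection onto the isotypic component of a character with
values `±1`. -/
theorem exists_isotypic_projection [CharZero k] {χ : G →* k} (hχ : ∀ g, χ g * χ g = 1)
    (ρ : Representation k G M) :
    ∃ (F : M →ₗ[k] M) (N : k), N ≠ 0 ∧ (∀ g s, F (ρ g s) = χ g • F s) ∧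
      ∀ s, (∀ g, ρ g s = χ g • s) → F s = N • s := by
  refine ⟨twistedSum χ ρ, (Fintype.card G : k), Nat.cast_ne_zero.mpr Fintype.card_ne_zero,
    twistedSum_rep hχ ρ, fun s hs => ?_⟩
  rw [twistedSum_apply]
  simp only [hs, smul_smul, hχ, one_smul, Finset.sum_const, Finset.card_univ,
    Nat.cast_smul_eq_nsmul]

end TwistedSum

section Antisymmetrize

variable {k : Type*} [Field k]

/-- The sign character of the symmetric group with values in `k`. -/
def signChar (k : Type*) [Field k] : Equiv.Perm (Fin 8) →* k where
  toFun σ := ((Equiv.Perm.sign σ : ℤ) : k)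
  map_one' := by simp
  map_mul' σ τ := by simp

theorem signChar_mul_self (σ : Equiv.Perm (Fin 8)) : signChar k σ * signChar k σ = 1 := by
  change ((Equiv.Perm.sign σ : ℤ) : k) * ((Equiv.Perm.sign σ : ℤ) : k) = 1
  rw [← Int.cast_mul, ← Units.val_mul, Int.units_mul_self]
  simp

theorem signChar_apply (σ : Equiv.Perm (Fin 8)) :
    signChar k σ = ((Equiv.Perm.sign σ : ℤ) : k) := rfl

/-- The action of the symmetric group on the symmetric algebra of `R₁`. -/
noncomputable def symRep (k : Type*) [Field k] :
    Representation k (Equiv.Perm (Fin 8)) (SymmetricAlgebra k (R₁ k)) where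
  toFun σ := (symMap (permRep k 8 1 σ)).toLinearMap
  map_one' := LinearMap.ext symMap_permRep_one
  map_mul' σ τ := LinearMap.ext (symMap_permRep_mul σ τ)

theorem symRep_apply (σ : Equiv.Perm (Fin 8)) (s : SymmetricAlgebra k (R₁ k)) :
    symRep k σ s = symMap (permRep k 8 1 σ) s := rfl

variable [CharZero k]

theorem symPower_three_eq_span : symPower k (R₁ k) 3 =
    Submodule.span k (Set.range fun t : Vec × Vec × Vec =>
      symForm k t.1 * symForm k t.2.1 * symForm k t.2.2) := by
  have h1 : LinearMap.range (SymmetricAlgebra.ι k (R₁ k)) =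
      Submodule.span k (Set.range (symForm k)) := by
    refine le_antisymm ?_ (Submodule.span_le.mpr ?_)
    · rintro _ ⟨f, rfl⟩
      obtain ⟨c, rfl⟩ := exists_eq_sum_steinerForm f
      rw [map_sum]
      refine Submodule.sum_mem _ fun p _ => ?_
      rw [map_smul]
      exact Submodule.smul_mem _ _ (Submodule.subset_span ⟨p, rfl⟩)
    · rintro _ ⟨p, rfl⟩
      exact ⟨_, rfl⟩
  rw [symPower, h1, pow_succ, pow_two, Submodule.span_mul_span, Submodule.span_mul_span]
  congr 1
  ext s
  constructor
  · rintro ⟨_, ⟨_, ⟨p, rfl⟩, _, ⟨q, rfl⟩, rfl⟩, _, ⟨r, rfl⟩, rfl⟩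
    exact ⟨(p, q, r), rfl⟩
  · rintro ⟨⟨p, q, r⟩, rfl⟩
    exact Set.mul_mem_mul (Set.mul_mem_mul ⟨p, rfl⟩ ⟨q, rfl⟩) ⟨r, rfl⟩

/-- Up to a scalar, there is a projection of the symmetric algebra onto its skew-invariant
elements. -/
theorem exists_antisymmetrization :
    ∃ (F : SymmetricAlgebra k (R₁ k) →ₗ[k] SymmetricAlgebra k (R₁ k)) (N : k), N ≠ 0 ∧
      (∀ (τ : Equiv.Perm (Fin 8)) (s : SymmetricAlgebra k (R₁ k)),
        F (symMap (permRep k 8 1 τ) s) = ((Equiv.Perm.sign τ : ℤ) : k) • F s) ∧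
      ∀ c ∈ skewCubics k, F c = N • c := by
  obtain ⟨F, N, hN, hrep, h⟩ :=
    exists_isotypic_projection (χ := signChar k) signChar_mul_self (symRep k)
  simp only [symRep_apply, signChar_apply] at h hrep
  refine ⟨F, N, hN, hrep, fun c hc => h c fun σ => ?_⟩
  rw [hc.2 σ, Int.cast_smul_eq_zsmul]

/-- The antisymmetrizations of all cubics are multiples of the antisymmetrization of one cube. -/
theorem exists_antisymmetrize_eq_smul
    {F : SymmetricAlgebra k (R₁ k) →ₗ[k] SymmetricAlgebra k (R₁ k)}
    (hF : ∀ (τ : Equiv.Perm (Fin 8)) (s : SymmetricAlgebra k (R₁ k)),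
      F (symMap (permRep k 8 1 τ) s) = ((Equiv.Perm.sign τ : ℤ) : k) • F s)
    {s : SymmetricAlgebra k (R₁ k)} (hs : s ∈ symPower k (R₁ k) 3) :
    ∃ c : k, F s = c • F (symForm k 1 * symForm k 1 * symForm k 1) := by
  have hcube : cubeSum k = ∑ p, symForm k p * symForm k p * symForm k p := by
    refine Finset.sum_congr rfl fun p _ => ?_
    ring
  have key := exists_smul_eq_of_transvection (k := k)
    (Φ := fun p q r => F (symForm k p * symForm k q * symForm k r))
    (fun q r => by simp [symForm_zero]) (fun p q r => by rw [mul_comm (symForm k p)])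
    (fun p q r => by rw [mul_right_comm])
    (fun p q => by rw [← map_sum, ← Finset.mul_sum, sum_symForm, mul_zero, map_zero])
    (fun v φ hv hφ h p q r => by
      have ht (p : Vec) : symForm k (transvection v φ p) =
          symMap (permRep k 8 1 (translation v φ)) (symForm k p) := by
        rw [symMap_symForm, permRep_translation_steinerForm hv hφ h, symForm]
      simp only [ht]
      rw [← map_mul, ← map_mul, hF, sign_translation hv hφ h]
      simp)
    (by
      simp only [← map_sum]
      rw [← hcube, ← lineSum, ← symMap_swap_cubeSum 0]
      have h4 (x : SymmetricAlgebra k (R₁ k)) : 4 * x = (4 : k) • x := by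
        rw [Algebra.smul_def, map_ofNat]
      rw [h4, map_smul, hF, Equiv.Perm.sign_swap (0 : Fin 7).castSucc_lt_succ.ne]
      simp)
  rw [symPower_three_eq_span] at hs
  induction hs using Submodule.span_induction with
  | mem s h =>
    obtain ⟨⟨p, q, r⟩, rfl⟩ := h
    exact key p q r
  | zero => exact ⟨0, by simp⟩
  | add s t _ _ h1 h2 =>
    obtain ⟨c, hc⟩ := h1
    obtain ⟨d, hd⟩ := h2
    exact ⟨c + d, by rw [map_add, hc, hd, add_smul]⟩
  | smul e s _ h1 =>
    obtain ⟨c, hc⟩ := h1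
    exact ⟨e * c, by rw [map_smul, hc, mul_smul]⟩

/-- Antisymmetrization multiplies both `c` and the skew cubic by a nonzero scalar and takes both
into one line. -/
theorem exists_eq_smul_skewCubic {c : SymmetricAlgebra k (R₁ k)} (hc : c ∈ skewCubics k) :
    ∃ t : k, c = t • skewCubic k := by
  obtain ⟨F, N, hN, hF, hFN⟩ := exists_antisymmetrization (k := k)
  obtain ⟨s, hs⟩ := exists_antisymmetrize_eq_smul hF hc.1
  obtain ⟨t, ht⟩ := exists_antisymmetrize_eq_smul hF skewCubic_mem.1
  rw [hFN c hc] at hs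
  rw [hFN _ skewCubic_mem] at ht
  have ht0 : t ≠ 0 := by
    rintro rfl
    rw [zero_smul, smul_eq_zero] at ht
    exact ht.elim hN skewCubic_ne_zero
  refine ⟨s * t⁻¹, ?_⟩
  rw [← smul_right_inj hN, hs, smul_comm, ht, smul_smul, inv_mul_cancel_right₀ ht0]

theorem finrank_skewCubics : Module.finrank k (skewCubics k) = 1 := by
  refine finrank_eq_one (⟨skewCubic k, skewCubic_mem⟩ : skewCubics k) (fun h => ?_) fun c => ?_
  · exact skewCubic_ne_zero (congrArg Subtype.val h)
  · obtain ⟨t, ht⟩ := exists_eq_smul_skewCubic c.2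
    exact ⟨t, Subtype.ext ht.symm⟩

end Antisymmetrize

/-! ### Linear syzygies and the annihilator -/

/-- A linear syzygy of the partial derivatives is the action of the linear map which takes the basis
to the coefficients of the syzygy. -/
theorem sum_mul_partialDeriv {k V ι : Type*} [Field k] [AddCommGroup V] [Module k V] [Fintype ι]
    (x : Module.Basis ι k V) (y : ι → V) (c : SymmetricAlgebra k V) :
    ∑ i, SymmetricAlgebra.ι k V (y i) * partialDeriv (x.coord i) c =
      lieAction (x.constr k y) c := by
  induction c using SymmetricAlgebra.induction with
  | algebraMap r => simp
  | ι v =>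
    rw [lieAction, symDerivation_ι, LinearMap.comp_apply, x.constr_apply_fintype k, map_sum]
    refine Finset.sum_congr rfl fun i _ => ?_
    rw [partialDeriv, symDerivation_ι]
    simp [Algebra.smul_def, mul_comm, x.equivFun_apply]
  | mul a b ha hb =>
    rw [Derivation.leibniz, ← ha, ← hb]
    simp only [Derivation.leibniz, smul_eq_mul, mul_add, Finset.sum_add_distrib, Finset.mul_sum]
    congr 1 <;> exact Finset.sum_congr rfl fun i _ => mul_left_comm _ _ _
  | add a b ha hb => simp only [map_add, mul_add, Finset.sum_add_distrib, ha, hb]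

end EightPoints

theorem theorem4p1 (k : Type*) [Field k] [CharZero k] :
    Module.finrank k (EightPoints.R₁ k) = 14 ∧
    Module.finrank k (EightPoints.skewCubics k) = 1 ∧
    ∀ c ∈ EightPoints.skewCubics k, c ≠ 0 →
      (∀ (x : Module.Basis (Fin 14) k (EightPoints.R₁ k)) (y : Fin 14 → EightPoints.R₁ k),
        ∑ i, SymmetricAlgebra.ι k (EightPoints.R₁ k) (y i) *
          EightPoints.partialDeriv (x.coord i) c = 0 → ∀ i, y i = 0) ∧
      (∀ A : Module.End k (EightPoints.R₁ k), EightPoints.lieAction A c = 0 → A = 0) := by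
  refine ⟨EightPoints.finrank_R₁, EightPoints.finrank_skewCubics, fun c hc hc0 => ?_⟩
  have hlie : ∀ A : Module.End k (EightPoints.R₁ k), EightPoints.lieAction A c = 0 → A = 0 := by
    intro A hA
    obtain ⟨t, rfl⟩ := EightPoints.exists_eq_smul_skewCubic hc
    have ht : t ≠ 0 := by
      rintro rfl
      exact hc0 (zero_smul _ _)
    rw [Derivation.map_smul, smul_eq_zero] at hA
    exact EightPoints.eq_zero_of_lieAction_skewCubic (hA.resolve_left ht)
  refine ⟨fun x y h i => ?_, hlie⟩
  rw [EightPoints.sum_mul_partialDeriv] at h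
  rw [← x.constr_basis k y i, hlie _ h, LinearMap.zero_apply]
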